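/- **Setting.** Consider an underactuated rigid body with mass $m>0$, symmetric positive definite inertia tensor $J\in\mathbb R^{3\times3}$, unit body-fixed thrust direction $e\in\mathbb R^3$, and known continuously differentiable external force $f_e(\xi,v)$ and torque $\tau_e(x)$. The state is $x=(R,\xi,\omega,v)\in \mathsf{TSE(3)}=\mathsf{SO(3)}\times\mathbb R^3\times\mathbb R^3\times\mathbb R^3$ and the input is $u=(T,\tau)\in\mathbb R\times\mathbb R^3$. Put $f(x,u)=T\,Re+f_e(\xi,v)$ and $\alpha(x,u)=J\omega\times\omega+\tau+\tau_e(x)$. For a sampling period $T_s>0$ the discrete-time dynamics $x^+=g_d(x,u)$ are $$\xi^+=\xi+T_sv,\qquad v^+=v+\tfrac{T_s}{m}f(x,u),\qquad \bar\omega=\omega+\tfrac{T_s}{2}J^{-1}\alpha(x,u),\qquad R^+=R\,\mathrm{cay}(T_s\bar\omega),\qquad \omega^+=\bar\omega+\tfrac{T_s}{2}J^{-1}\alpha(x,u),$$ where $\mathrm{cay}(\nu)=(I+\frac12\mathcal S(\nu))(I-\frac12\mathcal S(\nu))^{-1}$ and $\mathcal S(\nu)z=\nu\times z$. Write $x_u(j,x_0)$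 for the resulting trajectory. Let $R_d\in\mathsf{SO(3)}$, $x^e=(R_d,0,0,0)$ and $u^e=(T^e,0)$ with $T^e\neq0$, and suppose that the total force and torque vanish at equilibrium: $T^eR_de+f_e(0,0)=0$ and $\tau_e(x^e)=0$. Given gains $k_p,k_v,k_\omega,k_R,k_f,k_\tau,k_1,k_2>0$, orthonormal vectors $e_1,e_2\in\mathbb R^3$ and $\zeta>1$, let $\Psi(R,R_d)=\sum_{i=1}^2\frac{k_i}{2}\|Re_i-R_de_i\|^2$, $$\|\bar x\|_Q^2=k_p\|\xi\|^2+k_v\|v\|^2+k_\omega\|\omega\|^2+k_R\Psi(R,R_d)^2,\qquad \|\bar u\|_Q^2=k_f\|f(x,u)\|^2+k_\tau\|\tau\|^2 .$$ Given constraint sets $\mathbb X\subseteq\mathsf{TSE(3)}$ and $\mathbb U\subseteq\mathbb R\times\mathbb R^3$, the optimal control problem with horizon $N_p$ at $x_0$ is to minimize $$\sum_{j=0}^{N_p}\Big(\zeta^j\|\bar x(j)\|_Q^2+\|\bar u(j)\|_Q^2\Big)$$ over all $u(0),\dots,u(N_p)\in\mathbb U$ for which $x(j)=x_u(j,x_0)\in\mathbb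 X$ for $0\le j\le N_p$. The fast-motion NMPC scheme applies, at each feasible $x$, the first element $\kappa(x)$ of some optimal control sequence; the closed loop is $x(k+1)=g_d(x(k),\kappa(x(k)))$. The point $x^e$ is *practically asymptotically stable w.r.t. $\rho\ge0$ on $S$* (where $x^e\in S$) if it is an equilibrium of the closed loop and there is $\beta\in\mathcal{KL}$ with $\|x(k)-x^e\|\le\max\{\beta(\|x_0-x^e\|,k),\rho\}$ for all $x_0\in S$ and $k\in\mathbb N$. For $\varepsilon>0$ and $M\in\mathbb N$ let $S_{\varepsilon,M}$ be the set of initial states $x_0\in\mathbb X$ that can be steered into $\{x\in\mathbb X:\|x-x^e\|<\varepsilon\}$ in at most $M$ steps, using inputs in $\mathbb U$ and without leaving $\mathbb X$. **Theorem.** There is $T_0>0$ such that for every sampling period $0<T_s<T_0$ and all compact $\mathbb X\subseteq \mathsf{TSE(3)}$ and $\mathbb U\subseteq\mathbb R\times\mathbb R^3$ that are neighbourhoods of $x^e$ in $\mathsf{TSE(3)}$ and of $u^e$ in $\mathbb R\times\mathbb R^3$, respectively, there is $\varepsilon>0$ such that the following holds for all gains $k_p,k_v,k_\omega,k_R,k_f,k_\tau,k_1,k_2>0$,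 all orthonormal $e_1,e_2$, all $\zeta>1$ and all $M\in\mathbb N$. There are $N_0\ge4$ and a sequence $\rho_N\to0$ such that, for every horizon $N_p\ge N_0$, the optimal control problem has a solution at each feasible state, and for every NMPC feedback $\kappa$ the closed loop started anywhere in $S_{\varepsilon,M}$ remains feasible for all times, and $x^e$ is practically asymptotically stable w.r.t. $\rho_{N_p}$ on $S_{\varepsilon,M}$. In particular, stability holds on the whole $\varepsilon$-ball around $x^e$ in $\mathbb X$ (take $M=0$), and it is global on $\mathbb X$ whenever every state of $\mathbb X$ can be steered admissibly into that ball within a common number of steps. -/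

import Mathlib

open Filter Topology Matrix

/- Matrices carry the Frobenius norm. -/
attribute [local instance] Matrix.frobeniusNormedAddCommGroup Matrix.frobeniusNormedSpace

noncomputable section

namespace SE3MPC

abbrev Vec3 : Type := EuclideanSpace ℝ (Fin 3)

abbrev Mat3 : Type := Matrix (Fin 3) (Fin 3) ℝ

/-- The ambient normed space of the states `x = (R, ξ, ω, v)`; genuine states lie in `TSE3`. -/
abbrev State : Type := Mat3 × Vec3 × Vec3 × Vec3

/-- Controls `u = (T, τ)`: thrust and torque. -/
abbrev Control : Type := ℝ × Vec3

/-- Attitude `R`. -/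
abbrev rot (x : State) : Mat3 := x.1

/-- Position `ξ`. -/
abbrev pos (x : State) : Vec3 := x.2.1

/-- Body angular velocity `ω`. -/
abbrev angVel (x : State) : Vec3 := x.2.2.1

/-- Inertial linear velocity `v`. -/
abbrev vel (x : State) : Vec3 := x.2.2.2

/-- The rotation group `SO(3)`. -/
def SO3 : Set Mat3 := {R | R * Rᵀ = 1 ∧ R.det = 1}

/-- The state space `TSE(3)`, trivialized as `SO(3) × ℝ³ × ℝ³ × ℝ³`. -/
def TSE3 : Set State := {x | rot x ∈ SO3}

/-- Euclidean distance between states (Frobenius norm in the attitude component). -/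
def stateDist (x y : State) : ℝ :=
  Real.sqrt (‖rot x - rot y‖ ^ 2 + ‖pos x - pos y‖ ^ 2
    + ‖angVel x - angVel y‖ ^ 2 + ‖vel x - vel y‖ ^ 2)

/-- A matrix acting on a vector. -/
def act (A : Mat3) (w : Vec3) : Vec3 := WithLp.toLp 2 (A *ᵥ w.ofLp)

/-- The cross product on `ℝ³`. -/
def cross (a b : Vec3) : Vec3 := WithLp.toLp 2 (crossProduct a.ofLp b.ofLp)

/-- The skew-symmetric matrix `S(w)`, with `S(w) z = w × z`. -/
def skew (w : Vec3) : Mat3 :=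
  !![0, -w 2, w 1; w 2, 0, -w 0; -w 1, w 0, 0]

/-- The Cayley map. -/
def cay (w : Vec3) : Mat3 :=
  (1 + (1 / 2 : ℝ) • skew w) * (1 - (1 / 2 : ℝ) • skew w)⁻¹

/-- An underactuated rigid body on `SE(3)`: mass, inertia tensor, body-fixed thrust direction,
known external force `f_e(ξ, v)` and torque `τ_e(x)`. Only the values of `extTorque` on `TSE3`
matter; a continuously differentiable function on that closed submanifold extends to the ambient
space. -/
structure Vehicle where
  mass : ℝ
  inertia : Mat3
  dir : Vec3
  extForce : Vec3 × Vec3 → Vec3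
  extTorque : State → Vec3
  mass_pos : 0 < mass
  inertia_posDef : inertia.PosDef
  dir_unit : ‖dir‖ = 1
  extForce_contDiff : ContDiff ℝ 1 extForce
  extTorque_contDiff : ContDiff ℝ 1 extTorque

/-- Total force `f = R e T + f_e(ξ, v)`. -/
def Vehicle.force (P : Vehicle) (x : State) (u : Control) : Vec3 :=
  u.1 • act (rot x) P.dir + P.extForce (pos x, vel x)

/-- Total generalized torque `α = J ω × ω + τ + τ_e(x)`. -/
def Vehicle.torque (P : Vehicle) (x : State) (u : Control) : Vec3 :=
  cross (act P.inertia (angVel x)) (angVel x) + u.2 + P.extTorque x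

/-- The intermediate angular velocity `ω + (Ts / 2) J⁻¹ α`. -/
def Vehicle.midAngVel (P : Vehicle) (Ts : ℝ) (x : State) (u : Control) : Vec3 :=
  angVel x + (Ts / 2) • act P.inertia⁻¹ (P.torque x u)

/-- The discrete-time dynamics `x⁺ = g_d(x, u)` with sampling period `Ts`: Euler steps for position
and velocity, the Cayley-map integrator for attitude and angular velocity. -/
def Vehicle.step (P : Vehicle) (Ts : ℝ) (x : State) (u : Control) : State :=
  (rot x * cay (Ts • P.midAngVel Ts x u),
   pos x + Ts • vel x,
   P.midAngVel Ts x u + (Ts / 2) • act P.inertia⁻¹ (P.torque x u),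
   vel x + Ts • (P.mass⁻¹ • P.force x u))

/-- The state trajectory `x_u(j, x₀)`. -/
def Vehicle.traj (P : Vehicle) (Ts : ℝ) (x₀ : State) (u : ℕ → Control) : ℕ → State
  | 0 => x₀
  | j + 1 => P.step Ts (P.traj Ts x₀ u j) (u j)

/-- Weights of the stage cost: the gains, the exponential weight `ζ > 1`, and the two orthonormal
vectors and constants in the attitude error function. -/
structure Weights where
  kp : ℝ
  kv : ℝ
  kω : ℝ
  kR : ℝ
  kf : ℝ
  kτ : ℝ
  k₁ : ℝ
  k₂ : ℝ
  e₁ : Vec3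
  e₂ : Vec3
  ζ : ℝ
  kp_pos : 0 < kp
  kv_pos : 0 < kv
  kω_pos : 0 < kω
  kR_pos : 0 < kR
  kf_pos : 0 < kf
  kτ_pos : 0 < kτ
  k₁_pos : 0 < k₁
  k₂_pos : 0 < k₂
  e₁_unit : ‖e₁‖ = 1
  e₂_unit : ‖e₂‖ = 1
  e_orthogonal : inner ℝ e₁ e₂ = 0
  one_lt_ζ : 1 < ζ

/-- The attitude error function `Ψ(R, R_d) = k₁ Ψ₁ + k₂ Ψ₂`. -/
def Weights.attErr (W : Weights) (R Rd : Mat3) : ℝ :=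
  W.k₁ * ((1 / 2) * ‖act R W.e₁ - act Rd W.e₁‖ ^ 2)
    + W.k₂ * ((1 / 2) * ‖act R W.e₂ - act Rd W.e₂‖ ^ 2)

/-- The state cost `‖x̄‖²_Q`. -/
def Weights.stateCost (W : Weights) (Rd : Mat3) (x : State) : ℝ :=
  W.kp * ‖pos x‖ ^ 2 + W.kv * ‖vel x‖ ^ 2 + W.kω * ‖angVel x‖ ^ 2
    + W.kR * (W.attErr (rot x) Rd) ^ 2

/-- The input cost `‖ū‖²_Q`, in terms of the total force and the control torque. -/
def Weights.inputCost (W : Weights) (P : Vehicle) (x : State) (u : Control) : ℝ :=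
  W.kf * ‖P.force x u‖ ^ 2 + W.kτ * ‖u.2‖ ^ 2

/-- The cost of the optimal control problem with horizon `N`:
`∑_{j=0}^{N} (ζ^j ‖x̄(j)‖²_Q + ‖ū(j)‖²_Q)`. -/
def cost (P : Vehicle) (W : Weights) (Rd : Mat3) (Ts : ℝ) (N : ℕ) (x₀ : State)
    (u : ℕ → Control) : ℝ :=
  ∑ j ∈ Finset.range (N + 1),
    (W.ζ ^ j * W.stateCost Rd (P.traj Ts x₀ u j) + W.inputCost P (P.traj Ts x₀ u j) (u j))

/-- `u(0), …, u(N)` satisfies the input and state constraints from `x₀` on `{0, …, N}`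
(the later values of `u` are irrelevant). -/
def Admissible (P : Vehicle) (Ts : ℝ) (X : Set State) (U : Set Control) (N : ℕ) (x₀ : State)
    (u : ℕ → Control) : Prop :=
  ∀ j ≤ N, P.traj Ts x₀ u j ∈ X ∧ u j ∈ U

/-- The optimal control problem with horizon `N` is feasible at `x₀`. -/
def Feasible (P : Vehicle) (Ts : ℝ) (X : Set State) (U : Set Control) (N : ℕ) (x₀ : State) : Prop :=
  ∃ u, Admissible P Ts X U N x₀ u

/-- `u` solves the optimal control problem with horizon `N` at `x₀`. -/
def IsOptimal (P : Vehicle) (W : Weights) (Rd : Mat3) (Ts : ℝ) (X : Set State) (U : Set Control)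
    (N : ℕ) (x₀ : State) (u : ℕ → Control) : Prop :=
  Admissible P Ts X U N x₀ u ∧
    ∀ w, Admissible P Ts X U N x₀ w → cost P W Rd Ts N x₀ u ≤ cost P W Rd Ts N x₀ w

/-- `κ` is a feedback law generated by the NMPC iteration: at every feasible state it returns the
first element of some optimal control sequence. -/
def IsMPCFeedback (P : Vehicle) (W : Weights) (Rd : Mat3) (Ts : ℝ) (X : Set State)
    (U : Set Control) (N : ℕ) (κ : State → Control) : Prop :=
  ∀ x, Feasible P Ts X U N x → ∃ u, IsOptimal P W Rd Ts X U N x u ∧ κ x = u 0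

/-- The closed-loop map `x ↦ g_d(x, κ(x))`. -/
def closedLoop (P : Vehicle) (Ts : ℝ) (κ : State → Control) (x : State) : State :=
  P.step Ts x (κ x)

/-- Class `𝓚` functions, as functions on `[0, ∞)`. -/
def IsClassK (α : ℝ → ℝ) : Prop :=
  ContinuousOn α (Set.Ici 0) ∧ α 0 = 0 ∧ StrictMonoOn α (Set.Ici 0)

/-- Class `𝓚𝓛` functions, as functions on `[0, ∞) × [0, ∞)`. -/
def IsClassKL (β : ℝ → ℝ → ℝ) : Prop :=
  ContinuousOn (fun p : ℝ × ℝ => β p.1 p.2) (Set.Ici 0 ×ˢ Set.Ici 0) ∧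
    (∀ t, 0 ≤ t → IsClassK fun r => β r t) ∧
    ∀ r, 0 < r → StrictAntiOn (β r) (Set.Ici 0) ∧ Tendsto (β r) atTop (𝓝 0)

/-- The equilibrium `xe` of the autonomous system `x⁺ = F(x)` is practically asymptotically stable
with respect to `ρ` on `S`. -/
def PracticallyAsymptoticallyStable (F : State → State) (xe : State) (S : Set State) (ρ : ℝ) :
    Prop :=
  F xe = xe ∧ xe ∈ S ∧ 0 ≤ ρ ∧
    ∃ β, IsClassKL β ∧ ∀ x₀ ∈ S, ∀ k : ℕ,
      stateDist (F^[k] x₀) xe ≤ max (β (stateDist x₀ xe) k) ρ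

/-- The initial states from which some admissible control sequence steers the system into the
`ε`-ball around `xe` within at most `M` steps. -/
def controllableSet (P : Vehicle) (Ts : ℝ) (X : Set State) (U : Set Control) (xe : State)
    (ε : ℝ) (M : ℕ) : Set State :=
  {x₀ | ∃ u, ∃ j ≤ M, (∀ i ≤ j, P.traj Ts x₀ u i ∈ X) ∧ (∀ i < j, u i ∈ U) ∧
    stateDist (P.traj Ts x₀ u j) xe < ε}

end SE3MPC

end

/-! Let `d` be the distance to the equilibrium, `q` the state cost and `V` the optimal value.
Steering back from nearby costs `O(d²)`, but the attitude enters `q` through `Ψ²`, which is of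
fourth order. Thus `V ≤ C d²` near the equilibrium, while only `q ≥ c d⁴`, and the usual argument
from `V ≤ γ q` is not available. What survives is a descent `V(x⁺) ≤ V(x) - q(x) + δ`, where `δ → 0`
as the horizon grows.

Steering. The linearization at hover is controllable in four steps (`linStep_controllable`): torque
sets the angular velocity freely, and thrust together with tilt produces any force because `T^e ≠
0`. A short sampling period keeps the external force from spoiling the one equation left to solve.
Surjectivity of the derivative then steers nearby states exactly to hover, with deviations linear in
`d` (`exists_steering`). This involves only the dynamics and the constraints, so the radius `ε` does
not depend on the gains, on `ζ` or on `M`.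

Descent. The shifted optimal sequence loses the first stage, and its remaining state weights drop
from `ζ^(j+1)` to `ζ^j`. It is followed up to some time `k` and then rerouted to hover, at a cost of
order `ζ^k d(k)²`. A bound on the total cost makes `ζ^k q(k)` summable, but fourth-order control of
the attitude error `D` alone would allow `ζ^k D(k)²` to grow like `ζ^(k/2)`. The kinematics help:
`D` changes per step by at most a multiple of the angular velocities, whose squares are controlled
by `q` and hence decay like `ζ^(-j)`. Summing backwards from the end of the horizon bounds `D(k)` by
`O(ζ^(-k/2))` in its first half, and a weighted recursion even makes `ζ^k D(k)²` summable there.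
Some `k ≤ m ≤ N/2` therefore has rerouting cost `O(1/m)` (`exists_small_weighted`,
`exists_descent`).

Conclusion. Where `q > 2δ`, `V` falls by at least `δ`; where `q ≤ 2δ`, `d` and hence `V` are small.
So a small sublevel set of `V` is invariant and is reached in bounded time (`practical_lyapunov`),
and `q ≤ V` bounds `d` on it. -/

noncomputable section

namespace SE3MPC

/-- The topology of the Frobenius norm, which is the entrywise topology. -/
abbrev frobeniusTopology : TopologicalSpace Mat3 :=
  Matrix.frobeniusNormedAddCommGroup.toPseudoMetricSpace.toUniformSpace.toTopologicalSpace

attribute [local instance] frobeniusTopology Matrix.frobeniusNormedRing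
  Matrix.frobeniusNormedAlgebra

/-! ### Bilinear building blocks -/

lemma act_apply (A : Mat3) (w : Vec3) (i : Fin 3) :
    act A w i = A i 0 * w 0 + A i 1 * w 1 + A i 2 * w 2 := by
  simp [act, Matrix.mulVec, dotProduct, Fin.sum_univ_three]

/-- `act` as a continuous bilinear map. -/
def actL : Mat3 →L[ℝ] Vec3 →L[ℝ] Vec3 :=
  LinearMap.toContinuousLinearMap
    ((LinearMap.toContinuousLinearMap (𝕜 := ℝ) (E := Vec3) (F' := Vec3)).toLinearMap ∘ₗ
      LinearMap.mk₂ ℝ act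
        (fun A B w => by ext i; simp [act_apply]; ring)
        (fun c A w => by ext i; simp [act_apply]; ring)
        (fun A v w => by ext i; simp [act_apply]; ring)
        (fun c A w => by ext i; simp [act_apply]; ring))

@[simp] lemma actL_apply (A : Mat3) (w : Vec3) : actL A w = act A w := rfl

lemma cross_apply_zero (a b : Vec3) : cross a b 0 = a 1 * b 2 - a 2 * b 1 := by
  simp [cross, crossProduct]

lemma cross_apply_one (a b : Vec3) : cross a b 1 = a 2 * b 0 - a 0 * b 2 := by
  simp [cross, crossProduct]

lemma cross_apply_two (a b : Vec3) : cross a b 2 = a 0 * b 1 - a 1 * b 0 := by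
  simp [cross, crossProduct]

/-- `cross` as a continuous bilinear map. -/
def crossL : Vec3 →L[ℝ] Vec3 →L[ℝ] Vec3 :=
  LinearMap.toContinuousLinearMap
    ((LinearMap.toContinuousLinearMap (𝕜 := ℝ) (E := Vec3) (F' := Vec3)).toLinearMap ∘ₗ
      LinearMap.mk₂ ℝ cross
        (fun _ _ _ => by
          ext i; fin_cases i <;> simp [cross_apply_zero, cross_apply_one, cross_apply_two] <;> ring)
        (fun _ _ _ => by
          ext i; fin_cases i <;> simp [cross_apply_zero, cross_apply_one, cross_apply_two] <;> ring)
        (fun _ _ _ => by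
          ext i; fin_cases i <;> simp [cross_apply_zero, cross_apply_one, cross_apply_two] <;> ring)
        (fun _ _ _ => by
          ext i; fin_cases i <;> simp [cross_apply_zero, cross_apply_one, cross_apply_two] <;> ring))

@[simp] lemma crossL_apply (a b : Vec3) : crossL a b = cross a b := rfl

/-- `skew` as a continuous linear map. -/
def skewL : Vec3 →L[ℝ] Mat3 :=
  LinearMap.toContinuousLinearMap
    { toFun := skew
      map_add' := fun a b => by
        ext i j; fin_cases i <;> fin_cases j <;> simp [skew] <;> ring
      map_smul' := fun c a => by
        ext i j; fin_cases i <;> fin_cases j <;> simp [skew] }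

@[simp] lemma skewL_apply (w : Vec3) : skewL w = skew w := rfl

/-- The vector of the skew-symmetric part of a matrix. -/
def veeL : Mat3 →L[ℝ] Vec3 :=
  LinearMap.toContinuousLinearMap
    { toFun := fun A => !₂[(A 2 1 - A 1 2) / 2, (A 0 2 - A 2 0) / 2, (A 1 0 - A 0 1) / 2]
      map_add' := fun A B => by
        ext i; fin_cases i <;> simp <;> ring
      map_smul' := fun c A => by
        ext i; fin_cases i <;> simp <;> ring }

lemma veeL_apply (A : Mat3) :
    veeL A = !₂[(A 2 1 - A 1 2) / 2, (A 0 2 - A 2 0) / 2, (A 1 0 - A 0 1) / 2] := rfl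

@[simp] lemma veeL_skew (w : Vec3) : veeL (skew w) = w := by
  ext i; fin_cases i <;> simp [veeL_apply, skew]

/-- With `eq_one_of_symm_of_norm_lt`, this makes the skew part a usable coordinate for detecting the
identity among nearby rotations. -/
lemma transpose_eq_self_of_veeL_eq_zero {A : Mat3} (h : veeL A = 0) : Aᵀ = A := by
  have h0 := congrArg (fun v : Vec3 => v 0) h
  have h1 := congrArg (fun v : Vec3 => v 1) h
  have h2 := congrArg (fun v : Vec3 => v 2) h
  simp [veeL_apply] at h0 h1 h2
  ext i j
  fin_cases i <;> fin_cases j <;> simp <;> linarith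

lemma act_mul (A B : Mat3) (w : Vec3) : act (A * B) w = act A (act B w) := by
  simp [act, Matrix.mulVec_mulVec]

@[simp] lemma act_one (w : Vec3) : act 1 w = w := by simp [act]

lemma act_skew (a b : Vec3) : act (skew a) b = cross a b := by
  ext i
  fin_cases i <;>
    simp [act_apply, skew, cross_apply_zero, cross_apply_one, cross_apply_two] <;> ring

lemma skew_transpose (w : Vec3) : (skew w)ᵀ = -skew w := by
  ext i j; fin_cases i <;> fin_cases j <;> simp [skew]

/-! ### The rotation group -/

lemma one_mem_SO3 : (1 : Mat3) ∈ SO3 := by simp [SO3]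

lemma mul_mem_SO3 {A B : Mat3} (hA : A ∈ SO3) (hB : B ∈ SO3) : A * B ∈ SO3 := by
  refine ⟨?_, by rw [Matrix.det_mul, hA.2, hB.2, one_mul]⟩
  rw [Matrix.transpose_mul, Matrix.mul_assoc, ← Matrix.mul_assoc B, hB.1, Matrix.one_mul, hA.1]

lemma SO3_transpose_mul {R : Mat3} (hR : R ∈ SO3) : Rᵀ * R = 1 :=
  mul_eq_one_comm.1 hR.1

lemma transpose_mem_SO3 {R : Mat3} (hR : R ∈ SO3) : Rᵀ ∈ SO3 :=
  ⟨by rw [Matrix.transpose_transpose]; exact SO3_transpose_mul hR, by rw [Matrix.det_transpose, hR.2]⟩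

lemma frobenius_norm_sq (A : Mat3) : ‖A‖ ^ 2 = ∑ i, ∑ j, A i j ^ 2 := by
  rw [Matrix.frobenius_norm_def, ← Real.sqrt_eq_rpow, Real.sq_sqrt (by positivity)]
  simp

lemma norm_of_mem_SO3 {R : Mat3} (hR : R ∈ SO3) : ‖R‖ = Real.sqrt 3 := by
  have h : ‖R‖ ^ 2 = 3 := by
    have h1 := hR.1
    have key : ∀ i, ∑ j, R i j ^ 2 = 1 := fun i => by
      have := congrFun (congrFun h1 i) i
      simp only [Matrix.mul_apply, Matrix.transpose_apply, Matrix.one_apply_eq] at this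
      simpa [sq] using this
    rw [frobenius_norm_sq]; simp [key]
  rw [← h, Real.sqrt_sq (norm_nonneg _)]

/-! ### The Cayley map. -/

lemma det_one_sub_skew (w : Vec3) :
    (1 - (1 / 2 : ℝ) • skew w).det = 1 + (w 0 ^ 2 + w 1 ^ 2 + w 2 ^ 2) / 4 := by
  simp [Matrix.det_fin_three, skew]; ring

lemma det_one_add_skew (w : Vec3) :
    (1 + (1 / 2 : ℝ) • skew w).det = 1 + (w 0 ^ 2 + w 1 ^ 2 + w 2 ^ 2) / 4 := by
  simp [Matrix.det_fin_three, skew]; ring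

lemma isUnit_one_sub_skew (w : Vec3) : IsUnit (1 - (1 / 2 : ℝ) • skew w) := by
  rw [Matrix.isUnit_iff_isUnit_det, det_one_sub_skew]
  exact (by positivity : (0 : ℝ) < _).ne'.isUnit

lemma cay_mul (w : Vec3) :
    cay w * (1 - (1 / 2 : ℝ) • skew w) = 1 + (1 / 2 : ℝ) • skew w := by
  rw [cay, Matrix.mul_assoc, Matrix.nonsing_inv_mul _
    ((Matrix.isUnit_iff_isUnit_det _).1 (isUnit_one_sub_skew w)), Matrix.mul_one]

/-- The two factors `1 ± S/2` commute, are transposes of each other and have the same positive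
determinant. -/
lemma cay_mem_SO3 (w : Vec3) : cay w ∈ SO3 := by
  have hu := isUnit_one_sub_skew w
  have hd := (Matrix.isUnit_iff_isUnit_det _).1 hu
  constructor
  · have ht : (1 - (1 / 2 : ℝ) • skew w)ᵀ = 1 + (1 / 2 : ℝ) • skew w := by
      simp [Matrix.transpose_sub, skew_transpose]
    have hT : (1 + (1 / 2 : ℝ) • skew w)ᵀ = 1 - (1 / 2 : ℝ) • skew w := by
      rw [← ht, Matrix.transpose_transpose]
    have hd' : IsUnit (1 + (1 / 2 : ℝ) • skew w).det := by
      rw [← ht, Matrix.det_transpose]; exact hd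
    have hc : (1 + (1 / 2 : ℝ) • skew w) * (1 - (1 / 2 : ℝ) • skew w)
        = (1 - (1 / 2 : ℝ) • skew w) * (1 + (1 / 2 : ℝ) • skew w) := by
      simp only [mul_add, add_mul, mul_sub, sub_mul, mul_one, one_mul]; abel
    have hct : (cay w)ᵀ = (1 + (1 / 2 : ℝ) • skew w)⁻¹ * (1 - (1 / 2 : ℝ) • skew w) := by
      rw [cay, Matrix.transpose_mul, hT, Matrix.transpose_nonsing_inv, ht]
    apply mul_eq_one_comm.1
    rw [hct, cay, Matrix.mul_assoc, ← Matrix.mul_assoc (1 - (1 / 2 : ℝ) • skew w), ← hc,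
      Matrix.mul_assoc (1 + (1 / 2 : ℝ) • skew w), Matrix.mul_nonsing_inv _ hd, Matrix.mul_one,
      Matrix.nonsing_inv_mul _ hd']
  · have h := congrArg Matrix.det (cay_mul w)
    rw [Matrix.det_mul, det_one_sub_skew, det_one_add_skew] at h
    have hpos : (0 : ℝ) < 1 + (w 0 ^ 2 + w 1 ^ 2 + w 2 ^ 2) / 4 := by positivity
    exact mul_right_cancel₀ hpos.ne' (by rw [h, one_mul])

@[simp] lemma skew_zero : skew 0 = 0 := map_zero skewL

@[simp] lemma cay_zero : cay 0 = 1 := by simp [cay]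

lemma cay_sub_one (w : Vec3) : cay w - 1 = (1 / 2 : ℝ) • ((1 + cay w) * skew w) := by
  have h := cay_mul w
  rw [mul_sub, mul_one, sub_eq_iff_eq_add, mul_smul_comm] at h
  have h2 : skew w = (1 / 2 : ℝ) • skew w + (1 / 2 : ℝ) • skew w := by module
  rw [h, add_mul, one_mul, ← h]
  nth_rewrite 1 [h]
  module

/-- In `cay_sub_one` the factor `1 + cay w` is bounded, since all rotations have Frobenius norm
`√3`; so the estimate is global in `w`. -/
lemma exists_norm_cay_sub_one_le : ∃ C : ℝ, 0 ≤ C ∧ ∀ w, ‖cay w - 1‖ ≤ C * ‖w‖ := by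
  refine ⟨2⁻¹ * ((Real.sqrt 3 + Real.sqrt 3) * ‖skewL‖), by positivity, fun w => ?_⟩
  rw [cay_sub_one, norm_smul]
  have h1 : ‖(1 : Mat3) + cay w‖ ≤ Real.sqrt 3 + Real.sqrt 3 := by
    refine (norm_add_le _ _).trans ?_
    rw [norm_of_mem_SO3 (cay_mem_SO3 w), norm_of_mem_SO3 one_mem_SO3]
  have h2 : ‖skew w‖ ≤ ‖skewL‖ * ‖w‖ := skewL.le_opNorm w
  have h3 := (norm_mul_le (1 + cay w) (skew w)).trans
    (mul_le_mul h1 h2 (norm_nonneg _) (by positivity))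
  norm_num
  nlinarith

lemma contDiff_cay : ContDiff ℝ 1 cay := by
  have h1 : ContDiff ℝ 1 fun w : Vec3 => (1 : Mat3) + (1 / 2 : ℝ) • skew w :=
    contDiff_const.add (skewL.contDiff.const_smul _)
  have h2 : ContDiff ℝ 1 fun w : Vec3 => (1 : Mat3) - (1 / 2 : ℝ) • skew w :=
    contDiff_const.sub (skewL.contDiff.const_smul _)
  have h3 : ContDiff ℝ 1 fun w : Vec3 => ((1 : Mat3) - (1 / 2 : ℝ) • skew w)⁻¹ := by
    rw [contDiff_iff_contDiffAt]
    intro w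
    simp_rw [Matrix.nonsing_inv_eq_ringInverse]
    obtain ⟨a, ha⟩ := isUnit_one_sub_skew w
    have := contDiffAt_ringInverse ℝ (n := 1) a
    rw [ha] at this
    exact this.comp w h2.contDiffAt
  exact h1.mul h3

/-- Differentiating `cay w * (1 - S/2) = 1 + S/2` at zero gives `D - S/2 = S/2`, so the inverse need
not be differentiated explicitly. -/
lemma hasFDerivAt_cay_zero : HasFDerivAt cay skewL 0 := by
  have hD := (contDiff_cay.differentiable one_ne_zero 0).hasFDerivAt
  have h2 : HasFDerivAt (fun w : Vec3 => (1 : Mat3) - (1 / 2 : ℝ) • skew w)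
      (-((1 / 2 : ℝ) • skewL)) 0 := by
    simpa using (skewL.hasFDerivAt (x := 0)).const_smul (1 / 2 : ℝ) |>.const_sub (1 : Mat3)
  have h3 : HasFDerivAt (fun w : Vec3 => (1 : Mat3) + (1 / 2 : ℝ) • skew w)
      ((1 / 2 : ℝ) • skewL) 0 := by
    simpa using (skewL.hasFDerivAt (x := 0)).const_smul (1 / 2 : ℝ) |>.const_add (1 : Mat3)
  have h4 : HasFDerivAt (fun w : Vec3 => (1 : Mat3) + (1 / 2 : ℝ) • skew w) _ 0 :=
    (hD.mul' h2).congr_of_eventuallyEq (Eventually.of_forall fun w => (cay_mul w).symm)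
  have h5 := h4.unique h3
  have h6 : fderiv ℝ cay 0 = skewL := by
    ext1 w
    have := DFunLike.congr_fun h5 w
    simp at this
    rw [skewL_apply, ← sub_eq_zero]
    rw [← sub_eq_zero] at this
    rw [← this]
    module
  rwa [h6] at hD

/-- A symmetric rotation is an involution, so `(A - 1)² = -2 (A - 1)` and `2‖A - 1‖ ≤ ‖A - 1‖²`. The
norm condition excludes the half turns. -/
lemma eq_one_of_symm_of_norm_lt {A : Mat3} (hA : A ∈ SO3) (hs : Aᵀ = A) (hn : ‖A - 1‖ < 1) :
    A = 1 := by
  have h1 : A * A = 1 := by have := hA.1; rwa [hs] at this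
  have h2 : (A - 1) * (A - 1) = (-2 : ℝ) • (A - 1) := by
    rw [sub_mul, mul_sub, h1, mul_one, one_mul]; module
  have h3 : ‖(-2 : ℝ) • (A - 1)‖ ≤ ‖A - 1‖ * ‖A - 1‖ := h2 ▸ norm_mul_le _ _
  rw [norm_smul] at h3
  norm_num at h3
  have : ‖A - 1‖ = 0 := by nlinarith [norm_nonneg (A - 1)]
  exact sub_eq_zero.1 (norm_eq_zero.1 this)

/-! ### The cross product under rotations -/

lemma adjugate_of_mem_SO3 {R : Mat3} (hR : R ∈ SO3) : R.adjugate = Rᵀ := by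
  have h := Matrix.adjugate_mul R
  rw [hR.2, one_smul] at h
  calc R.adjugate = R.adjugate * (R * Rᵀ) := by rw [hR.1, mul_one]
    _ = Rᵀ := by rw [← mul_assoc, h, one_mul]

/-- A rotation is its own cofactor matrix, and cofactor matrices transform cross products. -/
lemma act_cross {R : Mat3} (hR : R ∈ SO3) (a b : Vec3) :
    act R (cross a b) = cross (act R a) (act R b) := by
  have h : R = R.adjugateᵀ := by rw [adjugate_of_mem_SO3 hR, Matrix.transpose_transpose]
  have h' : ∀ i j, R i j = R.adjugate j i := fun i j => congrFun (congrFun h i) j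
  have hadj := Matrix.adjugate_fin_three R
  ext i
  fin_cases i
  · change act R (cross a b) 0 = cross (act R a) (act R b) 0
    rw [act_apply, h' 0 0, h' 0 1, h' 0 2, hadj]
    simp [cross_apply_zero, cross_apply_one, cross_apply_two, act_apply]
    ring
  · change act R (cross a b) 1 = cross (act R a) (act R b) 1
    rw [act_apply, h' 1 0, h' 1 1, h' 1 2, hadj]
    simp [cross_apply_zero, cross_apply_one, cross_apply_two, act_apply]
    ring
  · change act R (cross a b) 2 = cross (act R a) (act R b) 2
    rw [act_apply, h' 2 0, h' 2 1, h' 2 2, hadj]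
    simp [cross_apply_zero, cross_apply_one, cross_apply_two, act_apply]
    ring

/-! ### Orthonormal frames and definiteness of the attitude error. -/

lemma inner_vec3 (a b : Vec3) : inner ℝ a b = a 0 * b 0 + a 1 * b 1 + a 2 * b 2 := by
  simp [PiLp.inner_apply, Fin.sum_univ_three]; ring

lemma norm_sq_vec3 (a : Vec3) : ‖a‖ ^ 2 = a 0 ^ 2 + a 1 ^ 2 + a 2 ^ 2 := by
  rw [EuclideanSpace.norm_sq_eq]; simp [Fin.sum_univ_three]

/-- The matrix with columns `a`, `b`, `a × b` has determinant `‖a‖²‖b‖² - ⟨a, b⟩² = 1`, so it can be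
cancelled. -/
lemma eq_zero_of_act_orthonormal {a b : Vec3} (ha : ‖a‖ = 1) (hb : ‖b‖ = 1)
    (hab : inner ℝ a b = 0) {A : Mat3} (h1 : act A a = 0) (h2 : act A b = 0)
    (h3 : act A (cross a b) = 0) : A = 0 := by
  have ha' : a 0 ^ 2 + a 1 ^ 2 + a 2 ^ 2 = 1 := by rw [← norm_sq_vec3, ha, one_pow]
  have hb' : b 0 ^ 2 + b 1 ^ 2 + b 2 ^ 2 = 1 := by rw [← norm_sq_vec3, hb, one_pow]
  rw [inner_vec3] at hab
  let E : Mat3 := !![a 0, b 0, cross a b 0; a 1, b 1, cross a b 1; a 2, b 2, cross a b 2]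
  have hdet : E.det = 1 := by
    have : E.det = (a 0 ^ 2 + a 1 ^ 2 + a 2 ^ 2) * (b 0 ^ 2 + b 1 ^ 2 + b 2 ^ 2)
        - (a 0 * b 0 + a 1 * b 1 + a 2 * b 2) ^ 2 := by
      simp [E, Matrix.det_fin_three, cross_apply_zero, cross_apply_one, cross_apply_two]; ring
    rw [this, ha', hb', hab]; norm_num
  have hAE : A * E = 0 := by
    ext i j
    have e1 := congrArg (fun v : Vec3 => v i) h1
    have e2 := congrArg (fun v : Vec3 => v i) h2
    have e3 := congrArg (fun v : Vec3 => v i) h3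
    simp only [act_apply] at e1 e2 e3
    fin_cases j
    · simpa [E, Matrix.mul_apply, Fin.sum_univ_three] using e1
    · simpa [E, Matrix.mul_apply, Fin.sum_univ_three] using e2
    · simpa [E, Matrix.mul_apply, Fin.sum_univ_three] using e3
  have hu : IsUnit E.det := by rw [hdet]; exact isUnit_one
  calc A = A * E * E⁻¹ := by rw [Matrix.mul_assoc, Matrix.mul_nonsing_inv _ hu, Matrix.mul_one]
    _ = 0 := by rw [hAE, Matrix.zero_mul]

lemma norm_act_le (A : Mat3) (w : Vec3) : ‖act A w‖ ≤ ‖actL‖ * ‖A‖ * ‖w‖ :=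
  actL.le_opNorm₂ A w

/-- The attitude error function controls the squared distance on `SO(3)`. -/
lemma Weights.exists_norm_sub_sq_le_attErr (W : Weights) {Rd : Mat3} (hRd : Rd ∈ SO3) :
    ∃ C : ℝ, 0 < C ∧ ∀ R ∈ SO3, ‖R - Rd‖ ^ 2 ≤ C * W.attErr R Rd := by
  let Φ : Mat3 →ₗ[ℝ] Vec3 × Vec3 × Vec3 :=
    ((actL.flip W.e₁).prod ((actL.flip W.e₂).prod (actL.flip (cross W.e₁ W.e₂)))).toLinearMap
  have hΦ : ∀ A, Φ A = (act A W.e₁, act A W.e₂, act A (cross W.e₁ W.e₂)) := fun A => rfl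
  have hker : LinearMap.ker Φ = ⊥ := by
    rw [LinearMap.ker_eq_bot']
    intro A hA
    rw [hΦ, Prod.mk_eq_zero, Prod.mk_eq_zero] at hA
    exact eq_zero_of_act_orthonormal W.e₁_unit W.e₂_unit W.e_orthogonal hA.1 hA.2.1 hA.2.2
  obtain ⟨K, hK, hanti⟩ := Φ.exists_antilipschitzWith hker
  -- This bounds the error on `e₁ × e₂` by the errors on `e₁` and `e₂`; the final `+ 1` gives `1 ≤
  -- c`, so one constant serves all three vectors.
  set c : ℝ := ‖crossL‖ * (‖actL‖ * Real.sqrt 3 + 1) + 1 with hc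
  have hc1 : 1 ≤ c := by
    have : 0 ≤ ‖crossL‖ * (‖actL‖ * Real.sqrt 3 + 1) := by positivity
    linarith
  have hk := lt_min W.k₁_pos W.k₂_pos
  set k := min W.k₁ W.k₂ with hkdef
  have hK' : (0 : ℝ) < K := by exact_mod_cast hK
  refine ⟨4 * ((K : ℝ) * c) ^ 2 / k, by positivity, fun R hR => ?_⟩
  set d1 := act R W.e₁ - act Rd W.e₁ with hd1
  set d2 := act R W.e₂ - act Rd W.e₂ with hd2
  -- Rotations preserve cross products, so the third error is the telescoped difference of two
  -- products. This is where membership in `SO3` is needed: two columns do not determine a general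
  -- matrix.
  have h3 : act R (cross W.e₁ W.e₂) - act Rd (cross W.e₁ W.e₂)
      = cross d1 (act R W.e₂) + cross (act Rd W.e₁) d2 := by
    rw [act_cross hR, act_cross hRd, ← crossL_apply, ← crossL_apply, ← crossL_apply, ← crossL_apply,
      hd1, hd2, map_sub, map_sub]
    simp
  have hb : ∀ Q ∈ SO3, ∀ w : Vec3, ‖w‖ = 1 → ‖act Q w‖ ≤ ‖actL‖ * Real.sqrt 3 := fun Q hQ w hw => by
    have := norm_act_le Q w
    rwa [norm_of_mem_SO3 hQ, hw, mul_one] at this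
  have hn3 : ‖act R (cross W.e₁ W.e₂) - act Rd (cross W.e₁ W.e₂)‖ ≤ c * (‖d1‖ + ‖d2‖) := by
    rw [h3]
    have e1 : ‖cross d1 (act R W.e₂)‖ ≤ ‖crossL‖ * ‖d1‖ * ‖act R W.e₂‖ := crossL.le_opNorm₂ _ _
    have e2 : ‖cross (act Rd W.e₁) d2‖ ≤ ‖crossL‖ * ‖act Rd W.e₁‖ * ‖d2‖ := crossL.le_opNorm₂ _ _
    have f1 := mul_le_mul_of_nonneg_left (hb R hR _ W.e₂_unit)
      (by positivity : 0 ≤ ‖crossL‖ * ‖d1‖)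
    have f2 := mul_le_mul_of_nonneg_left (hb Rd hRd _ W.e₁_unit)
      (by positivity : 0 ≤ ‖crossL‖ * ‖d2‖)
    refine (norm_add_le _ _).trans ?_
    have f3 : 0 ≤ ‖crossL‖ * (‖d1‖ + ‖d2‖) := by positivity
    rw [hc]
    nlinarith [norm_nonneg d1, norm_nonneg d2]
  have hn : ‖R - Rd‖ ≤ K * (c * (‖d1‖ + ‖d2‖)) := by
    have h := hanti.le_mul_dist R Rd
    rw [dist_eq_norm, dist_eq_norm] at h
    refine h.trans (mul_le_mul_of_nonneg_left ?_ hK'.le)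
    rw [hΦ, hΦ, Prod.mk_sub_mk, Prod.mk_sub_mk, Prod.norm_mk, Prod.norm_mk]
    have g1 := norm_nonneg d1
    have g2 := norm_nonneg d2
    refine max_le ?_ (max_le ?_ hn3)
    · exact (le_add_of_nonneg_right g2).trans (le_mul_of_one_le_left (by positivity) hc1)
    · exact (le_add_of_nonneg_left g1).trans (le_mul_of_one_le_left (by positivity) hc1)
  have hΨ : k * ((‖d1‖ + ‖d2‖) ^ 2) ≤ 4 * W.attErr R Rd := by
    have k1 : k ≤ W.k₁ := min_le_left _ _
    have k2 : k ≤ W.k₂ := min_le_right _ _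
    have a1 := mul_le_mul_of_nonneg_right k1 (sq_nonneg ‖d1‖)
    have a2 := mul_le_mul_of_nonneg_right k2 (sq_nonneg ‖d2‖)
    have a3 := mul_nonneg hk.le (sq_nonneg (‖d1‖ - ‖d2‖))
    simp only [Weights.attErr, ← hd1, ← hd2]
    nlinarith
  have hsq : ‖R - Rd‖ ^ 2 ≤ (K * c) ^ 2 * (‖d1‖ + ‖d2‖) ^ 2 := by
    rw [← mul_pow, mul_assoc]; exact pow_le_pow_left₀ (norm_nonneg _) hn 2
  refine hsq.trans ?_
  rw [div_mul_eq_mul_div, le_div_iff₀ hk]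
  nlinarith [mul_le_mul_of_nonneg_left hΨ (sq_nonneg ((K : ℝ) * c))]

section

lemma skew_add (a b : Vec3) : skew (a + b) = skew a + skew b := map_add skewL a b

lemma skew_smul (c : ℝ) (a : Vec3) : skew (c • a) = c • skew a := map_smul skewL c a

/-! ### Linearization of the dynamics -/

/-- The state at rest with attitude `Rd`. -/
abbrev hoverState (Rd : Mat3) : State := (Rd, 0, 0, 0)

/-- At attitude `Rd` and thrust `ue.1 ≠ 0`, without control torque, the vehicle is in equilibrium. -/
structure Vehicle.IsHover (P : Vehicle) (Rd : Mat3) (ue : Control) : Prop where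
  rot_mem : Rd ∈ SO3
  torque_eq : ue.2 = 0
  thrust_ne : ue.1 ≠ 0
  force_eq_zero : P.force (hoverState Rd) ue = 0
  torque_eq_zero : P.torque (hoverState Rd) ue = 0

/-- The attitude as a continuous linear map. -/
abbrev rotL : State →L[ℝ] Mat3 := ContinuousLinearMap.fst ℝ Mat3 (Vec3 × Vec3 × Vec3)

/-- The position as a continuous linear map. -/
abbrev posL : State →L[ℝ] Vec3 :=
  ContinuousLinearMap.fst ℝ Vec3 (Vec3 × Vec3) ∘L ContinuousLinearMap.snd ℝ Mat3 (Vec3 × Vec3 × Vec3)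

/-- The angular velocity as a continuous linear map. -/
abbrev angVelL : State →L[ℝ] Vec3 :=
  ContinuousLinearMap.fst ℝ Vec3 Vec3 ∘L ContinuousLinearMap.snd ℝ Vec3 (Vec3 × Vec3) ∘L
    ContinuousLinearMap.snd ℝ Mat3 (Vec3 × Vec3 × Vec3)

/-- The linear velocity as a continuous linear map. -/
abbrev velL : State →L[ℝ] Vec3 :=
  ContinuousLinearMap.snd ℝ Vec3 Vec3 ∘L ContinuousLinearMap.snd ℝ Vec3 (Vec3 × Vec3) ∘L
    ContinuousLinearMap.snd ℝ Mat3 (Vec3 × Vec3 × Vec3)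

variable (P : Vehicle) (Ts : ℝ)

lemma Vehicle.contDiff_force : ContDiff ℝ 1 fun p : State × Control => P.force p.1 p.2 := by
  have h1 : ContDiff ℝ 1 fun p : State × Control => act (rot p.1) P.dir :=
    (actL.contDiff.comp (by fun_prop : ContDiff ℝ 1 fun p : State × Control => p.1.1)).clm_apply
      contDiff_const
  have h2 : ContDiff ℝ 1 fun p : State × Control => P.extForce (pos p.1, vel p.1) :=
    P.extForce_contDiff.comp (by fun_prop)
  exact ((by fun_prop : ContDiff ℝ 1 fun p : State × Control => p.2.1).smul h1).add h2

lemma Vehicle.contDiff_torque : ContDiff ℝ 1 fun p : State × Control => P.torque p.1 p.2 := by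
  have hω : ContDiff ℝ 1 fun p : State × Control => angVel p.1 := by fun_prop
  have h1 : ContDiff ℝ 1 fun p : State × Control => act P.inertia (angVel p.1) :=
    (actL P.inertia).contDiff.comp hω
  have h2 : ContDiff ℝ 1 fun p : State × Control =>
      cross (act P.inertia (angVel p.1)) (angVel p.1) :=
    (crossL.contDiff.comp h1).clm_apply hω
  exact (h2.add (by fun_prop)).add (P.extTorque_contDiff.comp contDiff_fst)

lemma Vehicle.contDiff_inertia_inv_torque :
    ContDiff ℝ 1 fun p : State × Control => (Ts / 2) • act P.inertia⁻¹ (P.torque p.1 p.2) :=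
  ((actL P.inertia⁻¹).contDiff.comp P.contDiff_torque).const_smul _

lemma Vehicle.contDiff_midAngVel :
    ContDiff ℝ 1 fun p : State × Control => P.midAngVel Ts p.1 p.2 :=
  (by fun_prop : ContDiff ℝ 1 fun p : State × Control => p.1.2.2.1).add
    (P.contDiff_inertia_inv_torque Ts)

lemma Vehicle.contDiff_step : ContDiff ℝ 1 fun p : State × Control => P.step Ts p.1 p.2 := by
  refine ContDiff.prodMk ?_ (ContDiff.prodMk ?_ (ContDiff.prodMk ?_ ?_))
  · exact (by fun_prop : ContDiff ℝ 1 fun p : State × Control => p.1.1).mul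
      (contDiff_cay.comp ((P.contDiff_midAngVel Ts).const_smul Ts))
  · fun_prop
  · exact (P.contDiff_midAngVel Ts).add (P.contDiff_inertia_inv_torque Ts)
  · exact (by fun_prop : ContDiff ℝ 1 fun p : State × Control => p.1.2.2.2).add
      ((P.contDiff_force.const_smul _).const_smul Ts)

/-- The derivative of the external force at the origin. -/
def Vehicle.forceDeriv : Vec3 × Vec3 →L[ℝ] Vec3 := fderiv ℝ P.extForce (0, 0)

/-- The derivative of the external torque at the hover state. -/
def Vehicle.torqueDeriv (Rd : Mat3) : State →L[ℝ] Vec3 := fderiv ℝ P.extTorque (hoverState Rd)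

variable {P Ts} {Rd : Mat3} {ue : Control}

lemma Vehicle.hasFDerivAt_force (P : Vehicle) (Rd : Mat3) (ue : Control) :
    ∃ D : State × Control →L[ℝ] Vec3,
      HasFDerivAt (fun p : State × Control => P.force p.1 p.2) D (hoverState Rd, ue) ∧
      ∀ x u, D (x, u) = u.1 • act Rd P.dir + ue.1 • act (rot x) P.dir
        + P.forceDeriv (pos x, vel x) := by
  have hrot : HasFDerivAt (fun p : State × Control => rot p.1)
      (rotL ∘L ContinuousLinearMap.fst ℝ State Control) (hoverState Rd, ue) :=
    (rotL ∘L ContinuousLinearMap.fst ℝ State Control).hasFDerivAt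
  have h1 := (actL.flip P.dir).hasFDerivAt.comp (hoverState Rd, ue) hrot
  have hT : HasFDerivAt (fun p : State × Control => p.2.1)
      (ContinuousLinearMap.fst ℝ ℝ Vec3 ∘L ContinuousLinearMap.snd ℝ State Control) (hoverState Rd, ue) :=
    (ContinuousLinearMap.fst ℝ ℝ Vec3 ∘L ContinuousLinearMap.snd ℝ State Control).hasFDerivAt
  have hpv : HasFDerivAt (fun p : State × Control => (pos p.1, vel p.1))
      ((posL.prod velL) ∘L ContinuousLinearMap.fst ℝ State Control) (hoverState Rd, ue) :=
    ((posL.prod velL) ∘L ContinuousLinearMap.fst ℝ State Control).hasFDerivAt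
  have hf : HasFDerivAt P.extForce P.forceDeriv
      ((fun p : State × Control => (pos p.1, vel p.1)) (hoverState Rd, ue)) :=
    (P.extForce_contDiff.differentiable one_ne_zero _).hasFDerivAt
  refine ⟨_, (hT.smul h1).add (hf.comp (hoverState Rd, ue) hpv), fun x u => ?_⟩
  simp
  abel

lemma Vehicle.hasFDerivAt_torque (P : Vehicle) (Rd : Mat3) (ue : Control) :
    ∃ D : State × Control →L[ℝ] Vec3,
      HasFDerivAt (fun p : State × Control => P.torque p.1 p.2) D (hoverState Rd, ue) ∧
      ∀ x u, D (x, u) = u.2 + P.torqueDeriv Rd x := by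
  have hω : HasFDerivAt (fun p : State × Control => angVel p.1)
      (angVelL ∘L ContinuousLinearMap.fst ℝ State Control) (hoverState Rd, ue) :=
    (angVelL ∘L ContinuousLinearMap.fst ℝ State Control).hasFDerivAt
  have h1 := (actL P.inertia).hasFDerivAt.comp (hoverState Rd, ue) hω
  have h2 := crossL.hasFDerivAt_of_bilinear h1 hω
  have hu : HasFDerivAt (fun p : State × Control => p.2.2)
      (ContinuousLinearMap.snd ℝ ℝ Vec3 ∘L ContinuousLinearMap.snd ℝ State Control) (hoverState Rd, ue) :=
    (ContinuousLinearMap.snd ℝ ℝ Vec3 ∘L ContinuousLinearMap.snd ℝ State Control).hasFDerivAt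
  have hx : HasFDerivAt (fun p : State × Control => p.1)
      (ContinuousLinearMap.fst ℝ State Control) (hoverState Rd, ue) :=
    (ContinuousLinearMap.fst ℝ State Control).hasFDerivAt
  have hf : HasFDerivAt P.extTorque (P.torqueDeriv Rd)
      ((fun p : State × Control => p.1) (hoverState Rd, ue)) :=
    (P.extTorque_contDiff.differentiable one_ne_zero _).hasFDerivAt
  refine ⟨_, (h2.add hu).add (hf.comp (hoverState Rd, ue) hx), fun x u => ?_⟩
  have h0 : act P.inertia 0 = 0 := map_zero (actL P.inertia)
  simp [h0]
  exact map_zero (crossL (act P.inertia x.2.2.1))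

/-- The derivative of the dynamics at the hover equilibrium. -/
lemma Vehicle.IsHover.hasFDerivAt_step (h : P.IsHover Rd ue) (Ts : ℝ) :
    ∃ L : State × Control →L[ℝ] State,
      HasFDerivAt (fun p : State × Control => P.step Ts p.1 p.2) L (hoverState Rd, ue) ∧
      ∀ x u, L (x, u) =
        (rot x + Rd * skew (Ts • (angVel x + (Ts / 2) • act P.inertia⁻¹
            (u.2 + P.torqueDeriv Rd x))),
          pos x + Ts • vel x,
          angVel x + (Ts / 2) • act P.inertia⁻¹ (u.2 + P.torqueDeriv Rd x)
            + (Ts / 2) • act P.inertia⁻¹ (u.2 + P.torqueDeriv Rd x),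
          vel x + Ts • (P.mass⁻¹ • (u.1 • act Rd P.dir + ue.1 • act (rot x) P.dir
            + P.forceDeriv (pos x, vel x)))) := by
  obtain ⟨DF, hF, hF'⟩ := P.hasFDerivAt_force Rd ue
  obtain ⟨DT, hT, hT'⟩ := P.hasFDerivAt_torque Rd ue
  have hα : HasFDerivAt (fun p : State × Control => (Ts / 2) • act P.inertia⁻¹ (P.torque p.1 p.2))
      ((Ts / 2) • (actL P.inertia⁻¹ ∘L DT)) (hoverState Rd, ue) :=
    ((actL P.inertia⁻¹).hasFDerivAt.comp (hoverState Rd, ue) hT).const_smul (Ts / 2)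
  have hω : HasFDerivAt (fun p : State × Control => angVel p.1)
      (angVelL ∘L ContinuousLinearMap.fst ℝ State Control) (hoverState Rd, ue) :=
    (angVelL ∘L ContinuousLinearMap.fst ℝ State Control).hasFDerivAt
  have hm : HasFDerivAt (fun p : State × Control => P.midAngVel Ts p.1 p.2) _
    (hoverState Rd, ue) := hω.add hα
  have hm0 : Ts • P.midAngVel Ts (hoverState Rd) ue = 0 := by
    have h0 : act P.inertia⁻¹ 0 = 0 := map_zero (actL P.inertia⁻¹)
    simp [Vehicle.midAngVel, h.torque_eq_zero, h0]
  have hc : HasFDerivAt cay skewL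
      ((fun p : State × Control => Ts • P.midAngVel Ts p.1 p.2) (hoverState Rd, ue)) := by
    simpa only [hm0] using hasFDerivAt_cay_zero
  have hcay := hc.comp (hoverState Rd, ue) (hm.const_smul Ts)
  have hrot : HasFDerivAt (fun p : State × Control => rot p.1)
      (rotL ∘L ContinuousLinearMap.fst ℝ State Control) (hoverState Rd, ue) :=
    (rotL ∘L ContinuousLinearMap.fst ℝ State Control).hasFDerivAt
  have hpos : HasFDerivAt (fun p : State × Control => pos p.1)
      (posL ∘L ContinuousLinearMap.fst ℝ State Control) (hoverState Rd, ue) :=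
    (posL ∘L ContinuousLinearMap.fst ℝ State Control).hasFDerivAt
  have hvel : HasFDerivAt (fun p : State × Control => vel p.1)
      (velL ∘L ContinuousLinearMap.fst ℝ State Control) (hoverState Rd, ue) :=
    (velL ∘L ContinuousLinearMap.fst ℝ State Control).hasFDerivAt
  refine ⟨_, (hrot.mul' hcay).prodMk ((hpos.add (hvel.const_smul Ts)).prodMk
    ((hm.add hα).prodMk (hvel.add ((hF.const_smul P.mass⁻¹).const_smul Ts)))), fun x u => ?_⟩
  have hcay0 : cay (Ts • P.midAngVel Ts (hoverState Rd) ue) = 1 := by rw [hm0, cay_zero]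
  refine Prod.ext ?_ (Prod.ext ?_ (Prod.ext ?_ ?_))
  · simp only [ContinuousLinearMap.prod_apply]
    simp [hT', hcay0, skew_add, skew_smul, mul_add]
    abel
  · simp
  · simp [hT']
  · simp [hF']

end

section

/-! ### Controllability of the linearization in four steps -/

variable {P : Vehicle} {Ts : ℝ} {Rd : Mat3} {ue : Control}

lemma cross_cross_unit {e : Vec3} (he : ‖e‖ = 1) (b : Vec3) :
    cross (cross e b) e = b - inner ℝ e b • e := by
  have h : e 0 ^ 2 + e 1 ^ 2 + e 2 ^ 2 = 1 := by rw [← norm_sq_vec3, he, one_pow]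
  rw [inner_vec3]
  ext i
  fin_cases i <;> simp [cross_apply_zero, cross_apply_one, cross_apply_two]
  · linear_combination (b 0) * h
  · linear_combination (b 1) * h
  · linear_combination (b 2) * h

lemma unit_cross_cross {e : Vec3} (he : ‖e‖ = 1) (b : Vec3) :
    cross e (cross b e) = b - inner ℝ e b • e := by
  rw [← cross_cross_unit he]
  ext i
  fin_cases i <;> simp [cross_apply_zero, cross_apply_one, cross_apply_two] <;> ring

lemma act_inertia_inv (P : Vehicle) (w : Vec3) : act P.inertia⁻¹ (act P.inertia w) = w := by
  rw [← act_mul, Matrix.nonsing_inv_mul _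
    ((Matrix.isUnit_iff_isUnit_det _).1 P.inertia_posDef.isUnit), act_one]

/-- The linear maps that have the shape of the derivative of the dynamics at hover. -/
def Vehicle.IsLinStep (P : Vehicle) (Ts : ℝ) (Rd : Mat3) (ue : Control)
    (L : State × Control →L[ℝ] State) : Prop :=
  ∀ x u, L (x, u) =
    (rot x + Rd * skew (Ts • (angVel x + (Ts / 2) • act P.inertia⁻¹
        (u.2 + P.torqueDeriv Rd x))),
      pos x + Ts • vel x,
      angVel x + (Ts / 2) • act P.inertia⁻¹ (u.2 + P.torqueDeriv Rd x)
        + (Ts / 2) • act P.inertia⁻¹ (u.2 + P.torqueDeriv Rd x),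
      vel x + Ts • (P.mass⁻¹ • (u.1 • act Rd P.dir + ue.1 • act (rot x) P.dir
        + P.forceDeriv (pos x, vel x))))

/-- The torque can cancel the linearized external torque and realize any `ω'`, since the inertia is
invertible. Eliminating it leaves the trapezoidal rule for `θ`, with `ω'` and `T` as the free
parameters. -/
lemma Vehicle.IsLinStep.exists_input {L : State × Control →L[ℝ] State}
    (hL : P.IsLinStep Ts Rd ue L) (hTs : Ts ≠ 0) {θ θ' ξ ξ' ω ω' v v' : Vec3} {T : ℝ}
    (hξ : ξ' = ξ + Ts • v) (hθ : θ' = θ + (Ts / 2) • (ω + ω'))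
    (hv : v' = v + Ts • (P.mass⁻¹ • (T • act Rd P.dir + ue.1 • act Rd (cross θ P.dir)
      + P.forceDeriv (ξ, v)))) :
    ∃ u, L ((Rd * skew θ, ξ, ω, v), u) = (Rd * skew θ', ξ', ω', v') := by
  refine ⟨(T, Ts⁻¹ • act P.inertia (ω' - ω) - P.torqueDeriv Rd (Rd * skew θ, ξ, ω, v)), ?_⟩
  have hJ : act P.inertia⁻¹ (Ts⁻¹ • act P.inertia (ω' - ω)) = Ts⁻¹ • (ω' - ω) := by
    rw [← actL_apply, map_smul, actL_apply, act_inertia_inv]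
  have hhalf : (Ts / 2) • Ts⁻¹ • (ω' - ω) = (1 / 2 : ℝ) • (ω' - ω) := by
    rw [smul_smul]; congr 1; field_simp
  rw [hL, sub_add_cancel, hJ, hhalf]
  refine Prod.ext ?_ (Prod.ext ?_ (Prod.ext ?_ ?_))
  · change Rd * skew θ + Rd * skew (Ts • (ω + (1 / 2 : ℝ) • (ω' - ω))) = Rd * skew θ'
    rw [← mul_add, ← skew_add, hθ]
    congr 3
    module
  · exact hξ.symm
  · change ω + (1 / 2 : ℝ) • (ω' - ω) + (1 / 2 : ℝ) • (ω' - ω) = ω'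
    module
  · change v + Ts • (P.mass⁻¹ • (T • act Rd P.dir + ue.1 • act (Rd * skew θ) P.dir
      + P.forceDeriv (ξ, v))) = v'
    rw [hv, act_mul, act_skew]

lemma act_transpose_act {R : Mat3} (hR : R ∈ SO3) (w : Vec3) : act Rᵀ (act R w) = w := by
  rw [← act_mul, SO3_transpose_mul hR, act_one]

lemma act_act_transpose {R : Mat3} (hR : R ∈ SO3) (w : Vec3) : act R (act Rᵀ w) = w := by
  rw [← act_mul, hR.1, act_one]

/-- Any force is produced by some thrust and tilt, with arbitrary yaw. -/
lemma Vehicle.IsHover.thrust_add_tilt (h : P.IsHover Rd ue) (g : Vec3) (y : ℝ) :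
    inner ℝ P.dir (act Rdᵀ g) • act Rd P.dir
      + ue.1 • act Rd (cross (ue.1⁻¹ • cross P.dir (act Rdᵀ g) + y • P.dir) P.dir) = g := by
  have hee : cross P.dir P.dir = 0 := by simp [cross]
  have h1 : cross (ue.1⁻¹ • cross P.dir (act Rdᵀ g) + y • P.dir) P.dir
      = ue.1⁻¹ • (act Rdᵀ g - inner ℝ P.dir (act Rdᵀ g) • P.dir) := by
    rw [← cross_cross_unit P.dir_unit, ← crossL_apply, map_add, map_smul, map_smul]
    simp [hee]
  rw [h1, ← actL_apply Rd (ue.1⁻¹ • _), map_smul, smul_smul, mul_inv_cancel₀ h.thrust_ne, one_smul,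
    map_sub, map_smul, actL_apply, actL_apply, act_act_transpose h.rot_mem]
  abel

/-- For short sampling periods, the external force does not destroy controllability. -/
lemma Vehicle.exists_velocity (P : Vehicle) {Ts : ℝ} (hTs : 0 < Ts) (hTs1 : Ts ≤ 1)
    (hTs2 : Ts * ‖P.forceDeriv‖ < 2 * P.mass) (b : Vec3) :
    ∃ p : Vec3, (4 * P.mass / Ts) • p - P.forceDeriv (Ts • p, (-2 : ℝ) • p) = b := by
  let Λ : Vec3 →ₗ[ℝ] Vec3 :=
    { toFun := fun p => (4 * P.mass / Ts) • p - P.forceDeriv (Ts • p, (-2 : ℝ) • p)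
      map_add' := fun p q => by
        rw [smul_add, smul_add, smul_add, ← Prod.mk_add_mk, map_add]; abel
      map_smul' := fun c p => by
        rw [smul_comm _ c p, smul_comm _ c p, smul_comm _ c p, ← Prod.smul_mk, map_smul,
          RingHom.id_apply, smul_sub] }
  have hinj : Function.Injective Λ := by
    rw [← LinearMap.ker_eq_bot, LinearMap.ker_eq_bot']
    intro p hp
    have hp' : (4 * P.mass / Ts) • p = P.forceDeriv (Ts • p, (-2 : ℝ) • p) := sub_eq_zero.1 hp
    have h1 : ‖P.forceDeriv (Ts • p, (-2 : ℝ) • p)‖ ≤ ‖P.forceDeriv‖ * (2 * ‖p‖) := by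
      -- In the maximum norm `‖(Ts p, -2p)‖ ≤ 2‖p‖`, because `Ts ≤ 1`. A kernel vector would then
      -- satisfy `4m/Ts ‖p‖ ≤ 2‖A‖‖p‖`, with `A` the force derivative, against the smallness of
      -- `Ts`.
      refine (P.forceDeriv.le_opNorm _).trans (mul_le_mul_of_nonneg_left ?_ (norm_nonneg _))
      rw [Prod.norm_mk, norm_smul, norm_smul]
      refine max_le ?_ (by norm_num)
      rw [Real.norm_eq_abs, abs_of_pos hTs]
      nlinarith [norm_nonneg p]
    have hm := P.mass_pos
    rw [← hp', norm_smul, Real.norm_eq_abs, abs_of_pos (by positivity), div_mul_eq_mul_div,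
      div_le_iff₀ hTs] at h1
    by_contra hne
    have hpos : 0 < ‖p‖ := norm_pos_iff.2 hne
    nlinarith [mul_lt_mul_of_pos_right hTs2 hpos]
  exact (LinearMap.injective_iff_surjective.1 hinj) b

/-- The first step only tilts the body; the next three use forces `g₁`, `g₂`, `g₃` to give
velocities `p`, `v₃`, `v`. Reaching `ξ` fixes `v₃ = ξ/Ts - p`. Solving the trapezoidal rule from
rest through `θ₁`, `θ₂`, `θ₃` to `(θ, ω)` leaves the single condition `θ₃ - θ₂ + θ₁ = θ/2 - (Ts/4)
ω`, the right side being `c`. Its part orthogonal to the thrust axis is met by the choice of `p`,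
its part along the axis by the yaw of `θ₃`. -/
theorem Vehicle.IsHover.linStep_controllable (h : P.IsHover Rd ue)
    {L : State × Control →L[ℝ] State} (hL : P.IsLinStep Ts Rd ue L) (hTs : 0 < Ts) (hTs1 : Ts ≤ 1)
    (hTs2 : Ts * ‖P.forceDeriv‖ < 2 * P.mass) (θ ξ ω v : Vec3) :
    ∃ u₀ u₁ u₂ u₃, L (L (L (L (0, u₀), u₁), u₂), u₃) = (Rd * skew θ, ξ, ω, v) := by
  have hm := P.mass_pos
  have hTs0 := hTs.ne'
  obtain ⟨A₁, A₂, hA⟩ : ∃ A₁ A₂ : Vec3 →L[ℝ] Vec3, ∀ x y, P.forceDeriv (x, y) = A₁ x + A₂ y :=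
    ⟨P.forceDeriv ∘L ContinuousLinearMap.inl ℝ _ _, P.forceDeriv ∘L ContinuousLinearMap.inr ℝ _ _,
      fun x y => by simp [← map_add]⟩
  set e := P.dir with he
  set c : Vec3 := (1 / 2 : ℝ) • θ - (Ts / 4) • ω with hc
  -- This is `g₃ - g₂ + g₁ = T^e R_d (c × e)` written out as an equation for `p`; the coefficient
  -- `4m/Ts` collects the contributions `1 + 2 + 1` of the three velocity increments.
  obtain ⟨p, hp⟩ := P.exists_velocity hTs hTs1 hTs2
    (ue.1 • act Rd (cross c e) - (P.mass / Ts) • (v - (2 / Ts) • ξ) + A₂ (Ts⁻¹ • ξ))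
  rw [hA] at hp
  set v₃ : Vec3 := Ts⁻¹ • ξ - p with hv₃
  set g₁ : Vec3 := (P.mass / Ts) • p with hg₁
  set g₂ : Vec3 := (P.mass / Ts) • (v₃ - p) - (A₁ 0 + A₂ p) with hg₂
  set g₃ : Vec3 := (P.mass / Ts) • (v - v₃) - (A₁ (Ts • p) + A₂ v₃) with hg₃
  have hg : g₃ - g₂ + g₁ = ue.1 • act Rd (cross c e) := by
    simp only [map_smul] at hp
    simp only [hg₁, hg₂, hg₃, hv₃, map_sub, map_smul, map_zero]
    linear_combination (norm := module) hp
  let Θ : Vec3 → ℝ → Vec3 := fun g y => ue.1⁻¹ • cross e (act Rdᵀ g) + y • e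
  set θ₁ := Θ g₁ 0 with hθ₁
  set θ₂ := Θ g₂ 0 with hθ₂
  set θ₃ := Θ g₃ (inner ℝ e c) with hθ₃
  have hθ : θ₃ - θ₂ + θ₁ = c := by
    have h1 : θ₃ - θ₂ + θ₁ = ue.1⁻¹ • cross e (act Rdᵀ (g₃ - g₂ + g₁)) + inner ℝ e c • e := by
      simp only [hθ₁, hθ₂, hθ₃, Θ, ← actL_apply, ← crossL_apply, map_add, map_sub]
      module
    rw [h1, hg, ← actL_apply, map_smul, actL_apply, act_transpose_act h.rot_mem, ← crossL_apply,
      map_smul, crossL_apply, smul_smul, inv_mul_cancel₀ h.thrust_ne, one_smul,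
      unit_cross_cross P.dir_unit]
    abel
  -- The thrust and tilt chosen for `g` realize the velocity increment whatever the yaw `y`, which
  -- stays free to meet the condition on `c`.
  have hvel : ∀ g y v v' a, g = (P.mass / Ts) • (v' - v) - a →
      v' = v + Ts • (P.mass⁻¹ • (inner ℝ e (act Rdᵀ g) • act Rd e
        + ue.1 • act Rd (cross (Θ g y) e) + a)) := by
    intro g y v v' a hga
    rw [h.thrust_add_tilt g y, hga, sub_add_cancel, smul_smul, smul_smul,
      show Ts * P.mass⁻¹ * (P.mass / Ts) = 1 by field_simp, one_smul]
    abel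
  obtain ⟨u₀, h₀⟩ := hL.exists_input hTs0 (θ := 0) (θ' := θ₁) (ξ := 0) (ξ' := 0) (ω := 0)
    (ω' := (2 / Ts) • θ₁) (v := 0) (v' := 0) (T := 0) (by simp)
    (by rw [zero_add, zero_add, smul_smul]; field_simp; simp)
    (by
      have : cross 0 P.dir = 0 := by simp [cross]
      have h0 : act Rd 0 = 0 := map_zero (actL Rd)
      simp [hA, this, h0])
  obtain ⟨u₁, h₁⟩ := hL.exists_input hTs0 (θ := θ₁) (θ' := θ₂) (ξ := 0) (ξ' := 0)
    (ω := (2 / Ts) • θ₁) (ω' := (2 / Ts) • (θ₂ - (2 : ℝ) • θ₁)) (v := 0) (v' := p)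
    (T := inner ℝ e (act Rdᵀ g₁)) (by simp)
    (by
      rw [← smul_add, smul_smul, show Ts / 2 * (2 / Ts) = 1 by field_simp, one_smul]; module)
    (by rw [hA]; exact hvel g₁ 0 0 p _ (by simp [hg₁]))
  obtain ⟨u₂, h₂⟩ := hL.exists_input hTs0 (θ := θ₂) (θ' := θ₃) (ξ := 0) (ξ' := Ts • p)
    (ω := (2 / Ts) • (θ₂ - (2 : ℝ) • θ₁)) (ω' := (2 / Ts) • (θ₃ - (2 : ℝ) • θ₂ + (2 : ℝ) • θ₁))
    (v := p) (v' := v₃)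
    (T := inner ℝ e (act Rdᵀ g₂)) (by simp)
    (by
      rw [← smul_add, smul_smul, show Ts / 2 * (2 / Ts) = 1 by field_simp, one_smul]; module)
    (by rw [hA]; exact hvel g₂ 0 p v₃ _ hg₂)
  obtain ⟨u₃, h₃⟩ := hL.exists_input hTs0 (θ := θ₃) (θ' := θ) (ξ := Ts • p) (ξ' := ξ)
    (ω := (2 / Ts) • (θ₃ - (2 : ℝ) • θ₂ + (2 : ℝ) • θ₁)) (ω' := ω)
    (v := v₃) (v' := v)
    (T := inner ℝ e (act Rdᵀ g₃))
    (by rw [hv₃, smul_sub, smul_smul, mul_inv_cancel₀ hTs0, one_smul]; abel)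
    (by
      have h2 : θ = (2 : ℝ) • c + (Ts / 2) • ω := by rw [hc]; module
      rw [smul_add, smul_smul, show Ts / 2 * (2 / Ts) = 1 by field_simp, one_smul, h2, ← hθ]
      module)
    (by rw [hA]; exact hvel g₃ _ v₃ v _ hg₃)
  have hz : (0 : State) = (Rd * skew 0, 0, 0, 0) := by simp; rfl
  exact ⟨u₀, u₁, u₂, u₃, by rw [hz, h₀, h₁, h₂, h₃]⟩

end

section

/-! ### Local steering to the equilibrium -/

/-- Near a point with surjective strict derivative, preimages can be chosen at linearly controlled
distance. -/
lemma exists_preimage_norm_sub_le {E F : Type*} [NormedAddCommGroup E] [NormedSpace ℝ E]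
    [CompleteSpace E] [NormedAddCommGroup F] [NormedSpace ℝ F] [CompleteSpace F]
    {f : E → F} {f' : E →L[ℝ] F} {a : E} (hf : HasStrictFDerivAt f f' a)
    (hf' : Function.Surjective f') :
    ∃ C : ℝ, 0 < C ∧ ∃ r : ℝ, 0 < r ∧ ∀ y, ‖y - f a‖ < r → ∃ x, f x = y ∧
      ‖x - a‖ ≤ C * ‖y - f a‖ := by
  let g := f'.nonlinearRightInverseOfSurjective (LinearMap.range_eq_top.2 hf')
  have hg : 0 < g.nnnorm := f'.nonlinearRightInverseOfSurjective_nnnorm_pos _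
  have hg' : (0 : ℝ) < (g.nnnorm : ℝ)⁻¹ := by positivity
  -- Half of the invertibility margin `g.nnnorm⁻¹` is given to the nonlinearity; the other half
  -- leaves the constant `2 * g.nnnorm` below.
  obtain ⟨s, hs, happ⟩ := hf.approximates_deriv_on_nhds (c := g.nnnorm⁻¹ / 2)
    (Or.inr (by positivity))
  obtain ⟨δ, hδ, hball⟩ := Metric.nhds_basis_closedBall.mem_iff.1 hs
  refine ⟨2 * g.nnnorm, by positivity, (2 * (g.nnnorm : ℝ))⁻¹ * δ, by positivity, fun y hy => ?_⟩
  have hy' : 2 * (g.nnnorm : ℝ) * ‖y - f a‖ ≤ δ := by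
    rw [inv_mul_eq_div, lt_div_iff₀ (by positivity)] at hy
    linarith
  obtain ⟨x, hx, hxy⟩ := happ.surjOn_closedBall_of_nonlinearRightInverse g
    (ε := 2 * g.nnnorm * ‖y - f a‖) (b := a) (by positivity)
    ((Metric.closedBall_subset_closedBall hy').trans hball) (a := y) (by
      rw [mem_closedBall_iff_norm]
      push_cast
      field_simp
      norm_num)
  exact ⟨x, hxy, mem_closedBall_iff_norm.1 hx⟩

lemma HasFDerivAt.eventually_norm_le {E F : Type*} [NormedAddCommGroup E] [NormedSpace ℝ E]
    [NormedAddCommGroup F] [NormedSpace ℝ F] {f : E → F} {f' : E →L[ℝ] F} {a : E}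
    (hf : HasFDerivAt f f' a) :
    ∃ C : ℝ, 0 ≤ C ∧ ∀ᶠ x in 𝓝 a, ‖f x - f a‖ ≤ C * ‖x - a‖ := by
  obtain ⟨C, hC, h⟩ := hf.isBigO_sub.exists_nonneg
  exact ⟨C, hC, h.bound⟩

variable {P : Vehicle} {Ts : ℝ} {Rd : Mat3} {ue : Control}

/-! ### Trajectories near hover and their dependence on the first four inputs. -/

lemma step_mem_TSE3 {x : State} (hx : x ∈ TSE3) (u : Control) : P.step Ts x u ∈ TSE3 :=
  mul_mem_SO3 hx (cay_mem_SO3 _)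

lemma traj_mem_TSE3 {x : State} (hx : x ∈ TSE3) (u : ℕ → Control) (j : ℕ) :
    P.traj Ts x u j ∈ TSE3 := by
  induction j with
  | zero => exact hx
  | succ j ih => exact step_mem_TSE3 ih _

lemma Vehicle.IsHover.step_eq (h : P.IsHover Rd ue) (Ts : ℝ) :
    P.step Ts (hoverState Rd) ue = hoverState Rd := by
  have h0 : act P.inertia⁻¹ 0 = 0 := map_zero (actL P.inertia⁻¹)
  have h1 : P.midAngVel Ts (hoverState Rd) ue = 0 := by
    rw [Vehicle.midAngVel, h.torque_eq_zero, h0, smul_zero, add_zero]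
  rw [Vehicle.step, h1, h.torque_eq_zero, h.force_eq_zero, h0]
  simp

/-- The input sequence that starts with `z` and continues with `ue`. -/
def extendInput (ue : Control) (z : Fin 4 → Control) (j : ℕ) : Control :=
  if hj : j < 4 then z ⟨j, hj⟩ else ue

lemma extendInput_const (ue : Control) : extendInput ue (fun _ => ue) = fun _ => ue := by
  ext1 j; simp [extendInput]

lemma contDiff_extendInput (ue : Control) (j : ℕ) :
    ContDiff ℝ 1 fun p : State × (Fin 4 → Control) => extendInput ue p.2 j := by
  unfold extendInput
  split_ifs
  · fun_prop
  · exact contDiff_const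

lemma contDiff_traj (P : Vehicle) (Ts : ℝ) (ue : Control) (j : ℕ) :
    ContDiff ℝ 1 fun p : State × (Fin 4 → Control) => P.traj Ts p.1 (extendInput ue p.2) j := by
  induction j with
  | zero => exact contDiff_fst
  | succ j ih => exact (P.contDiff_step Ts).comp (ih.prodMk (contDiff_extendInput ue j))

lemma Vehicle.IsHover.traj_eq (h : P.IsHover Rd ue) (Ts : ℝ) (j : ℕ) :
    P.traj Ts (hoverState Rd) (fun _ => ue) j = hoverState Rd := by
  induction j with
  | zero => rfl
  | succ j ih => rw [Vehicle.traj, ih, h.step_eq]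

/-- The base trajectory stays at hover, so the chain rule uses the same `L` at every step and the
derivatives obey the linearized dynamics. -/
lemma Vehicle.IsHover.hasFDerivAt_traj (h : P.IsHover Rd ue) (Ts : ℝ)
    {L : State × Control →L[ℝ] State}
    (hL : HasFDerivAt (fun p : State × Control => P.step Ts p.1 p.2) L (hoverState Rd, ue)) :
    ∃ D : ℕ → (State × (Fin 4 → Control) →L[ℝ] State),
      (∀ j, HasFDerivAt (fun p : State × (Fin 4 → Control) =>
        P.traj Ts p.1 (extendInput ue p.2) j) (D j) (hoverState Rd, fun _ => ue)) ∧
      (∀ p, D 0 p = p.1) ∧ ∀ j (hj : j < 4) p, D (j + 1) p = L (D j p, p.2 ⟨j, hj⟩) := by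
  let I : ℕ → (State × (Fin 4 → Control) →L[ℝ] Control) := fun j =>
    if hj : j < 4 then ContinuousLinearMap.proj (R := ℝ) (φ := fun _ : Fin 4 => Control) ⟨j, hj⟩ ∘L
      ContinuousLinearMap.snd ℝ State (Fin 4 → Control) else 0
  have hI : ∀ j, HasFDerivAt (fun p : State × (Fin 4 → Control) => extendInput ue p.2 j) (I j)
      (hoverState Rd, fun _ => ue) := by
    intro j
    unfold extendInput
    simp only [I]
    split_ifs with hj
    · exact (ContinuousLinearMap.proj (R := ℝ) (φ := fun _ : Fin 4 => Control) ⟨j, hj⟩ ∘L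
        ContinuousLinearMap.snd ℝ State (Fin 4 → Control)).hasFDerivAt
    · exact hasFDerivAt_const _ _
  let D : ℕ → (State × (Fin 4 → Control) →L[ℝ] State) := fun j =>
    Nat.rec (ContinuousLinearMap.fst ℝ State (Fin 4 → Control)) (fun j Dj => L ∘L Dj.prod (I j)) j
  refine ⟨D, fun j => ?_, fun p => rfl, fun j hj p => ?_⟩
  · induction j with
    | zero => exact (ContinuousLinearMap.fst ℝ State (Fin 4 → Control)).hasFDerivAt
    | succ j ih =>
      have hp : (P.traj Ts (hoverState Rd) (extendInput ue fun _ => ue) j,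
          extendInput ue (fun _ => ue) j) = (hoverState Rd, ue) := by
        rw [extendInput_const, h.traj_eq]
      have hL' : HasFDerivAt (fun p : State × Control => P.step Ts p.1 p.2) L
          ((fun p : State × (Fin 4 → Control) => (P.traj Ts p.1 (extendInput ue p.2) j,
            extendInput ue p.2 j)) (hoverState Rd, fun _ => ue)) := by
        simp only [hp]; exact hL
      exact hL'.comp (hoverState Rd, fun _ => ue) (ih.prodMk (hI j))
  · change L (D j p, I j p) = _
    simp [I, hj]

/-- The deviation from the hover state, in a chart of `SO(3)` at `Rd`. -/
def deviationL (Rd : Mat3) : State →L[ℝ] Vec3 × Vec3 × Vec3 × Vec3 :=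
  (veeL ∘L ContinuousLinearMap.mul ℝ Mat3 Rdᵀ ∘L rotL).prod (posL.prod (angVelL.prod velL))

lemma deviationL_apply (Rd : Mat3) (x : State) :
    deviationL Rd x = (veeL (Rdᵀ * rot x), pos x, angVel x, vel x) := rfl

lemma deviationL_hoverState (hRd : Rd ∈ SO3) : deviationL Rd (hoverState Rd) = 0 := by
  have h1 : veeL 1 = 0 := by ext i; fin_cases i <;> simp [veeL_apply]
  rw [deviationL_apply, SO3_transpose_mul hRd, h1]
  rfl

lemma eq_hoverState_of_deviationL_eq_zero (hRd : Rd ∈ SO3) {x : State} (hx : x ∈ TSE3)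
    (h0 : deviationL Rd x = 0) (hn : ‖Rdᵀ * rot x - 1‖ < 1) : x = hoverState Rd := by
  rw [deviationL_apply] at h0
  simp only [Prod.mk_eq_zero] at h0
  have h1 := eq_one_of_symm_of_norm_lt (mul_mem_SO3 (transpose_mem_SO3 hRd) hx)
    (transpose_eq_self_of_veeL_eq_zero h0.1) hn
  have h2 : rot x = Rd := by
    calc rot x = Rd * (Rdᵀ * rot x) := by rw [← mul_assoc, hRd.1, one_mul]
      _ = Rd := by rw [h1, mul_one]
  exact Prod.ext h2 (Prod.ext h0.2.1 (Prod.ext h0.2.2.1 h0.2.2.2))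

/-- States near the equilibrium are steered into it in four steps, at a linear cost. -/
theorem Vehicle.IsHover.exists_steering (h : P.IsHover Rd ue) (hTs : 0 < Ts) (hTs1 : Ts ≤ 1)
    (hTs2 : Ts * ‖P.forceDeriv‖ < 2 * P.mass) :
    ∃ C : ℝ, 0 < C ∧ ∃ r : ℝ, 0 < r ∧ ∀ x ∈ TSE3, ‖x - hoverState Rd‖ < r →
      ∃ u : ℕ → Control, ∀ i, ‖P.traj Ts x u i - hoverState Rd‖ ≤ C * ‖x - hoverState Rd‖ ∧
        ‖u i - ue‖ ≤ C * ‖x - hoverState Rd‖ ∧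
        ‖P.force (P.traj Ts x u i) (u i)‖ ≤ C * ‖x - hoverState Rd‖ ∧
        (4 ≤ i → P.traj Ts x u i = hoverState Rd ∧ u i = ue) := by
  obtain ⟨L, hL, hL'⟩ := h.hasFDerivAt_step Ts
  obtain ⟨D, hD, hD0, hD'⟩ := h.hasFDerivAt_traj Ts hL
  set p₀ : State × (Fin 4 → Control) := (hoverState Rd, fun _ => ue) with hp₀
  have htraj₀ : ∀ i, P.traj Ts p₀.1 (extendInput ue p₀.2) i = hoverState Rd := fun i => by
    rw [hp₀, extendInput_const, h.traj_eq]
  -- Retaining the initial state as a component lets it be prescribed along with the final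
  -- deviation. Only the final state is read in the chart, so the derivative can be surjective
  -- although states live in the larger ambient space.
  let H : State × (Fin 4 → Control) → State × (Vec3 × Vec3 × Vec3 × Vec3) := fun p =>
    (p.1, deviationL Rd (P.traj Ts p.1 (extendInput ue p.2) 4))
  have hH0 : H p₀ = (hoverState Rd, 0) := by
    change (hoverState Rd, deviationL Rd (P.traj Ts p₀.1 (extendInput ue p₀.2) 4)) = _
    rw [htraj₀, deviationL_hoverState h.rot_mem]
  have hHc : ContDiff ℝ 1 H :=
    contDiff_fst.prodMk ((deviationL Rd).contDiff.comp (contDiff_traj P Ts ue 4))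
  have hHd : HasFDerivAt H ((ContinuousLinearMap.fst ℝ State (Fin 4 → Control)).prod
      (deviationL Rd ∘L D 4)) p₀ :=
    hasFDerivAt_fst.prodMk ((deviationL Rd).hasFDerivAt.comp p₀ (hD 4))
  have hHs := hHc.contDiffAt.hasStrictFDerivAt' hHd one_ne_zero
  have hsurj : Function.Surjective ((ContinuousLinearMap.fst ℝ State (Fin 4 → Control)).prod
      (deviationL Rd ∘L D 4)) := by
    rintro ⟨a, y⟩
    -- The inputs need only produce what the free evolution of `a` leaves missing, so
    -- controllability from the origin suffices.
    obtain ⟨θ, ξ, ω, v, hy⟩ : ∃ θ ξ ω v, y - deviationL Rd (D 4 (a, 0)) = (θ, ξ, ω, v) :=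
      ⟨_, _, _, _, rfl⟩
    obtain ⟨u₀, u₁, u₂, u₃, hu⟩ := h.linStep_controllable hL' hTs hTs1 hTs2 θ ξ ω v
    refine ⟨(a, ![u₀, u₁, u₂, u₃]), ?_⟩
    have h4 : D 4 (0, ![u₀, u₁, u₂, u₃]) = (Rd * skew θ, ξ, ω, v) := by
      rw [hD' 3 (by norm_num), hD' 2 (by norm_num), hD' 1 (by norm_num), hD' 0 (by norm_num), hD0]
      exact hu
    have hsplit : ((a, ![u₀, u₁, u₂, u₃]) : State × (Fin 4 → Control))
        = (a, 0) + (0, ![u₀, u₁, u₂, u₃]) := by simp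
    refine Prod.ext rfl ?_
    change deviationL Rd (D 4 (a, ![u₀, u₁, u₂, u₃])) = y
    rw [hsplit, map_add, map_add, h4, deviationL_apply]
    change deviationL Rd (D 4 (a, 0)) + (veeL (Rdᵀ * (Rd * skew θ)), ξ, ω, v) = y
    rw [← mul_assoc, SO3_transpose_mul h.rot_mem, one_mul, veeL_skew, ← hy]
    abel
  obtain ⟨C, hC, r, hr, hpre⟩ := exists_preimage_norm_sub_le hHs hsurj
  have hb : ∀ i, ∃ K : ℝ, 0 ≤ K ∧ ∀ᶠ p in 𝓝 p₀,
      ‖P.traj Ts p.1 (extendInput ue p.2) i - hoverState Rd‖ ≤ K * ‖p - p₀‖ := fun i => by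
    simpa only [htraj₀] using HasFDerivAt.eventually_norm_le (hD i)
  have hf : ∀ i, ∃ K : ℝ, 0 ≤ K ∧ ∀ᶠ p in 𝓝 p₀,
      ‖P.force (P.traj Ts p.1 (extendInput ue p.2) i) (extendInput ue p.2 i)‖ ≤ K * ‖p - p₀‖ := by
    intro i
    have hc := (P.contDiff_force.comp ((contDiff_traj P Ts ue i).prodMk
      (contDiff_extendInput ue i))).differentiable one_ne_zero p₀
    obtain ⟨K, hK, hev⟩ := HasFDerivAt.eventually_norm_le hc.hasFDerivAt
    refine ⟨K, hK, hev.mono fun p hp => ?_⟩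
    have h0 : P.force (P.traj Ts p₀.1 (extendInput ue p₀.2) i) (extendInput ue p₀.2 i) = 0 := by
      rw [htraj₀, hp₀, extendInput_const, h.force_eq_zero]
    simpa [h0] using hp
  choose K₁ hK₁ hb using hb
  choose K₂ hK₂ hf using hf
  have hnear : ∀ᶠ p in 𝓝 p₀,
      ‖Rdᵀ * rot (P.traj Ts p.1 (extendInput ue p.2) 4) - 1‖ < 1 := by
    have hc : Continuous fun p : State × (Fin 4 → Control) =>
        ‖Rdᵀ * rot (P.traj Ts p.1 (extendInput ue p.2) 4) - 1‖ :=
      ((continuous_const.mul (continuous_fst.comp (contDiff_traj P Ts ue 4).continuous)).sub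
        continuous_const).norm
    refine hc.continuousAt.eventually_lt continuousAt_const ?_
    rw [htraj₀, SO3_transpose_mul h.rot_mem, sub_self, norm_zero]
    exact one_pos
  have hall : ∀ᶠ p in 𝓝 p₀, (∀ i ∈ Finset.range 5,
      ‖P.traj Ts p.1 (extendInput ue p.2) i - hoverState Rd‖ ≤ K₁ i * ‖p - p₀‖ ∧
      ‖P.force (P.traj Ts p.1 (extendInput ue p.2) i) (extendInput ue p.2 i)‖
        ≤ K₂ i * ‖p - p₀‖) ∧
      ‖Rdᵀ * rot (P.traj Ts p.1 (extendInput ue p.2) 4) - 1‖ < 1 :=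
    ((Filter.eventually_all_finset _).2 fun i _ => (hb i).and (hf i)).and hnear
  obtain ⟨δ, hδ, hall⟩ := Metric.eventually_nhds_iff.1 hall
  -- The summand `1` makes the same constant cover the deviation of the inputs, which are components
  -- of `p` itself.
  set K : ℝ := 1 + ∑ i ∈ Finset.range 5, (K₁ i + K₂ i) with hK
  have hKle : ∀ i ∈ Finset.range 5, K₁ i + K₂ i ≤ K := fun i hi => by
    have : K₁ i + K₂ i ≤ _ := Finset.single_le_sum (f := fun i => K₁ i + K₂ i)
      (fun i _ => add_nonneg (hK₁ i) (hK₂ i)) hi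
    linarith
  have hK1 : 1 ≤ K := by
    have := Finset.sum_nonneg (s := Finset.range 5) (f := fun i => K₁ i + K₂ i)
      (fun i _ => add_nonneg (hK₁ i) (hK₂ i))
    linarith
  refine ⟨K * C, by positivity, min r (δ / C), lt_min hr (by positivity), fun x hx hxr => ?_⟩
  have hnorm : ‖((x, 0) : State × (Vec3 × Vec3 × Vec3 × Vec3)) - H p₀‖ = ‖x - hoverState Rd‖ := by
    rw [hH0, Prod.mk_sub_mk, sub_zero, Prod.norm_mk, norm_zero, max_eq_left (norm_nonneg _)]
  obtain ⟨p, hpH, hpn⟩ := hpre (x, 0) (by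
    rw [hnorm]
    exact hxr.trans_le (min_le_left _ _))
  rw [hnorm] at hpn
  obtain ⟨y, z⟩ := p
  obtain rfl : y = x := congrArg Prod.fst hpH
  have hz : deviationL Rd (P.traj Ts y (extendInput ue z) 4) = 0 := congrArg Prod.snd hpH
  have hd : dist ((y, z) : State × (Fin 4 → Control)) p₀ < δ := by
    rw [dist_eq_norm]
    have h2 := hxr.trans_le (min_le_right r (δ / C))
    rw [lt_div_iff₀ hC] at h2
    linarith
  obtain ⟨hall, hnear⟩ := hall hd
  have h4 := eq_hoverState_of_deviationL_eq_zero h.rot_mem (traj_mem_TSE3 hx _ _) hz hnear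
  have hlate : ∀ i, 4 ≤ i → P.traj Ts y (extendInput ue z) i = hoverState Rd ∧
      extendInput ue z i = ue := by
    intro i hi
    have hu : ∀ i, 4 ≤ i → extendInput ue z i = ue := fun i hi => by
      simp [extendInput, Nat.not_lt.2 hi]
    refine ⟨?_, hu i hi⟩
    induction i, hi using Nat.le_induction with
    | base => exact h4
    | succ i hi ih => rw [Vehicle.traj, ih, hu i hi, h.step_eq]
  have hn0 := norm_nonneg (y - hoverState Rd)
  have hbound : ∀ k, k ≤ K → k * ‖((y, z) : State × (Fin 4 → Control)) - p₀‖
      ≤ K * C * ‖y - hoverState Rd‖ := fun k hk => by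
    rw [mul_assoc]
    exact mul_le_mul hk hpn (norm_nonneg _) (by positivity)
  refine ⟨extendInput ue z, fun i => ?_⟩
  have hpos : 0 ≤ K * C * ‖y - hoverState Rd‖ := by positivity
  rcases lt_or_ge i 4 with hi | hi
  · have hi5 : i ∈ Finset.range 5 := Finset.mem_range.2 (by omega)
    obtain ⟨g1, g2⟩ := hall i hi5
    have g3 := hKle i hi5
    refine ⟨g1.trans (hbound _ (by linarith [hK₂ i])), ?_, g2.trans (hbound _ (by linarith [hK₁ i])),
      fun hi' => absurd hi (by omega)⟩
    refine le_trans ?_ (hbound 1 hK1)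
    rw [one_mul, extendInput, dif_pos hi]
    exact (norm_le_pi_norm (z - fun _ => ue) ⟨i, hi⟩).trans (norm_snd_le ((y, z) - p₀))
  · obtain ⟨g1, g2⟩ := hlate i hi
    refine ⟨?_, ?_, ?_, fun _ => ⟨g1, g2⟩⟩
    · rwa [g1, sub_self, norm_zero]
    · rwa [g2, sub_self, norm_zero]
    · rwa [g1, g2, h.force_eq_zero, norm_zero]

end

/-! ### Exponentially weighted sums -/

/-- If `D` varies slowly, in terms of an exponentially decaying quantity `q`, then `ζ ^ k * D k ^ 2`
is small on average. The a priori bound on `D N` is weak: only its fourth power is controlled. -/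
lemma exists_small_weighted {ζ c B : ℝ} (hζ : 1 < ζ) (hc : 0 ≤ c) (hB : 0 ≤ B) :
    ∃ K : ℝ, 0 < K ∧ ∀ (N m : ℕ), 1 ≤ m → 2 * m ≤ N → ∀ D q w : ℕ → ℝ,
      (∀ j, 0 ≤ D j) → (∀ j, 0 ≤ q j) → (∀ j, 0 ≤ w j) → (∀ j ≤ N, w j ^ 2 ≤ c * q j) →
      (∀ j < N, D j ≤ D (j + 1) + c * (w j + w (j + 1))) → D N ^ 4 ≤ c * q N →
      ∑ j ∈ Finset.range (N + 1), ζ ^ j * q j ≤ B →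
      ∃ k, 1 ≤ k ∧ k ≤ m ∧ ζ ^ k * (D k ^ 2 + q k) ≤ K / m := by
  have hζ0 : 0 < ζ := one_pos.trans hζ
  -- The rate for quantities entering as squares: bounds on `ζ^j w²` become bounds on `s^j w`.
  set s := Real.sqrt ζ with hs
  have hs2 : s ^ 2 = ζ := Real.sq_sqrt hζ0.le
  have hs1 : 1 < s := by rw [hs]; exact Real.lt_sqrt_of_sq_lt (by simpa using hζ)
  have hs0 : 0 < s := one_pos.trans hs1
  set b := Real.sqrt (c * B) with hb
  have hb0 : 0 ≤ b := Real.sqrt_nonneg _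
  have hb2 : b ^ 2 = c * B := Real.sq_sqrt (by positivity)
  -- `A` is the fixed point of `t ↦ t / s + 2 c b`, the recursion behind `hdecay`.
  set A : ℝ := 2 * c * b * s / (s - 1) with hA
  have hs1' : 0 < s - 1 := sub_pos.2 hs1
  have hA0 : 0 ≤ A := by positivity
  have hAeq : A / s + 2 * c * b = A := by rw [hA]; field_simp; ring
  set T : ℝ := (1 + c * B + A) ^ 2 with hT
  set C : ℝ := 2 * c ^ 3 * (s / (s - 1)) with hC
  have hC0 : 0 ≤ C := by positivity
  set S : ℝ := (T + 2 * C * B * s) / (s - 1) with hS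
  have hT0 : 0 ≤ T := sq_nonneg _
  have hS0 : 0 ≤ S := by positivity
  refine ⟨S + T + B + 1, by positivity, fun N m hm hmN D q w hD hq hw hwq hDD hDN hsum => ?_⟩
  have hterm : ∀ j ≤ N, ζ ^ j * q j ≤ B := fun j hj =>
    (Finset.single_le_sum (f := fun j => ζ ^ j * q j)
      (fun i _ => mul_nonneg (pow_nonneg hζ0.le i) (hq i))
      (Finset.mem_range.2 (Nat.lt_succ_of_le hj))).trans hsum
  have hsw : ∀ j ≤ N, s ^ j * w j ≤ b := fun j hj => by
    refine abs_le_of_sq_le_sq' ?_ hb0 |>.2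
    rw [mul_pow, ← pow_mul, mul_comm j 2, pow_mul, hs2, hb2]
    calc ζ ^ j * w j ^ 2 ≤ ζ ^ j * (c * q j) :=
          mul_le_mul_of_nonneg_left (hwq j hj) (pow_nonneg hζ0.le j)
      _ = c * (ζ ^ j * q j) := by ring
      _ ≤ c * B := mul_le_mul_of_nonneg_left (hterm j hj) hc
  have hsw' : ∀ j < N, s ^ j * w (j + 1) ≤ b := fun j hj => by
    refine le_trans ?_ (hsw (j + 1) hj)
    exact mul_le_mul_of_nonneg_right (pow_le_pow_right₀ hs1.le (Nat.le_succ j)) (hw _)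
  have hstep : ∀ j < N, s ^ j * D j ≤ s ^ (j + 1) * D (j + 1) / s
      + c * (s ^ j * w j + s ^ j * w (j + 1)) := fun j hj => by
    have h1 := mul_le_mul_of_nonneg_left (hDD j hj) (pow_nonneg hs0.le j)
    have h2 : s ^ (j + 1) * D (j + 1) / s = s ^ j * D (j + 1) := by
      rw [pow_succ]; field_simp
    rw [h2]
    linarith
  have hdecay : ∀ i ≤ N, s ^ (N - i) * D (N - i) ≤ s ^ (N - i) * D N + A := by
    intro i
    induction i with
    | zero => intro _; simpa using hA0
    | succ i ih =>
      intro hi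
      have ih := ih (by omega)
      obtain ⟨k, hk⟩ : ∃ k, N - (i + 1) = k := ⟨_, rfl⟩
      have hk' : N - i = k + 1 := by omega
      rw [hk'] at ih
      rw [hk]
      have hkN : k < N := by omega
      have h1 := hstep k hkN
      have h2 := hsw k hkN.le
      have h3 := hsw' k hkN
      have h4 : s ^ (k + 1) * D (k + 1) / s ≤ s ^ k * D N + A / s := by
        rw [div_le_iff₀ hs0, add_mul, div_mul_cancel₀ _ hs0.ne']
        calc _ ≤ _ := ih
          _ = _ := by ring
      have h5 := mul_le_mul_of_nonneg_left (add_le_add h2 h3) hc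
      linarith
  -- Here `2 m ≤ N` is essential: `(s^m D N)^4 = ζ^(2m) (D N)^4 ≤ c ζ^N q N`, so the weak
  -- fourth-order bound at the end is strong enough halfway.
  have hTm : ζ ^ m * D m ^ 2 ≤ T := by
    have h1 := hdecay (N - m) (by omega)
    rw [Nat.sub_sub_self (by omega : m ≤ N)] at h1
    have h2 : (s ^ m * D N) ^ 4 ≤ c * B := by
      calc (s ^ m * D N) ^ 4 = ζ ^ (2 * m) * D N ^ 4 := by rw [← hs2]; ring
        _ ≤ ζ ^ N * (c * q N) := mul_le_mul (pow_le_pow_right₀ hζ.le hmN) hDN (by positivity)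
          (by positivity)
        _ = c * (ζ ^ N * q N) := by ring
        _ ≤ c * B := mul_le_mul_of_nonneg_left (hterm N le_rfl) hc
    have h3 : s ^ m * D N ≤ 1 + c * B := by
      by_contra hlt
      push Not at hlt
      have h4 : 1 < s ^ m * D N := by
        have : 0 ≤ c * B := by positivity
        linarith
      have h5 := le_self_pow₀ h4.le (by norm_num : 4 ≠ 0)
      linarith
    have h4 : ζ ^ m * D m ^ 2 = (s ^ m * D m) ^ 2 := by rw [← hs2]; ring
    rw [h4, hT]
    exact pow_le_pow_left₀ (mul_nonneg (by positivity) (hD m)) (by linarith) 2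
  have hrec : ∀ k < N, ζ ^ k * D k ^ 2 ≤ ζ ^ (k + 1) * D (k + 1) ^ 2 / s
      + C * (ζ ^ k * q k + ζ ^ (k + 1) * q (k + 1)) := by
    intro k hk
    have h1 := hstep k hk
    set x := s ^ (k + 1) * D (k + 1) with hx
    set y := c * (s ^ k * w k + s ^ k * w (k + 1)) with hy
    have h0 : 0 ≤ s ^ k * D k := mul_nonneg (by positivity) (hD k)
    have h2 : (s ^ k * D k) ^ 2 ≤ (x / s + y) ^ 2 := pow_le_pow_left₀ h0 h1 2
    -- Convexity of the square with weights `1/s` and `1 - 1/s`. The coefficient `1/s < 1` in front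
    -- of `x ^ 2` allows the sum to be absorbed below.
    have h3 : (x / s + y) ^ 2 ≤ x ^ 2 / s + s / (s - 1) * y ^ 2 := by
      have h4 : x ^ 2 / s + s / (s - 1) * y ^ 2 - (x / s + y) ^ 2
          = ((s - 1) * x - s * y) ^ 2 / (s ^ 2 * (s - 1)) := by field_simp; ring
      have h5 : 0 ≤ ((s - 1) * x - s * y) ^ 2 / (s ^ 2 * (s - 1)) := by positivity
      linarith
    have h4 : y ^ 2 ≤ 2 * c ^ 3 * (ζ ^ k * q k + ζ ^ (k + 1) * q (k + 1)) := by
      have e1 : (s ^ k * w k) ^ 2 ≤ c * (ζ ^ k * q k) := by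
        calc (s ^ k * w k) ^ 2 = ζ ^ k * w k ^ 2 := by rw [← hs2]; ring
          _ ≤ ζ ^ k * (c * q k) := mul_le_mul_of_nonneg_left (hwq k hk.le) (by positivity)
          _ = _ := by ring
      have e2 : (s ^ k * w (k + 1)) ^ 2 ≤ c * (ζ ^ (k + 1) * q (k + 1)) := by
        calc (s ^ k * w (k + 1)) ^ 2 = ζ ^ k * w (k + 1) ^ 2 := by rw [← hs2]; ring
          _ ≤ ζ ^ (k + 1) * (c * q (k + 1)) :=
            mul_le_mul (pow_le_pow_right₀ hζ.le (Nat.le_succ k)) (hwq (k + 1) hk) (by positivity)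
              (by positivity)
          _ = _ := by ring
      have e3 : (s ^ k * w k + s ^ k * w (k + 1)) ^ 2
          ≤ 2 * c * (ζ ^ k * q k + ζ ^ (k + 1) * q (k + 1)) := by
        have := add_sq_le (a := s ^ k * w k) (b := s ^ k * w (k + 1))
        linarith
      calc y ^ 2 = c ^ 2 * (s ^ k * w k + s ^ k * w (k + 1)) ^ 2 := by rw [hy]; ring
        _ ≤ c ^ 2 * (2 * c * (ζ ^ k * q k + ζ ^ (k + 1) * q (k + 1))) :=
          mul_le_mul_of_nonneg_left e3 (by positivity)
        _ = _ := by ring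
    have h5 := mul_le_mul_of_nonneg_left h4 (by positivity : 0 ≤ s / (s - 1))
    have h6 : ζ ^ k * D k ^ 2 = (s ^ k * D k) ^ 2 := by rw [← hs2]; ring
    have h7 : ζ ^ (k + 1) * D (k + 1) ^ 2 = x ^ 2 := by rw [hx, ← hs2]; ring
    have h8 : C * (ζ ^ k * q k + ζ ^ (k + 1) * q (k + 1))
        = s / (s - 1) * (2 * c ^ 3 * (ζ ^ k * q k + ζ ^ (k + 1) * q (k + 1))) := by rw [hC]; ring
    rw [h6, h7, h8]
    linarith
  have hq0 : ∀ n ≤ N + 1, ∑ j ∈ Finset.range n, ζ ^ j * q j ≤ B := fun n hn =>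
    (Finset.sum_le_sum_of_subset_of_nonneg (Finset.range_mono hn)
      (fun i _ _ => mul_nonneg (by positivity) (hq i))).trans hsum
  have hq1 : ∑ j ∈ Finset.range m, ζ ^ (j + 1) * q (j + 1) ≤ B := by
    have h1 := hq0 (m + 1) (by omega)
    rw [Finset.sum_range_succ'] at h1
    have : 0 ≤ ζ ^ 0 * q 0 := mul_nonneg (by positivity) (hq 0)
    linarith
  set Z := ∑ k ∈ Finset.range m, ζ ^ k * D k ^ 2 with hZ
  have hshift : ∑ k ∈ Finset.range m, ζ ^ (k + 1) * D (k + 1) ^ 2 ≤ Z + T := by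
    have h1 := Finset.sum_range_succ' (fun k => ζ ^ k * D k ^ 2) m
    rw [Finset.sum_range_succ] at h1
    have : 0 ≤ ζ ^ 0 * D 0 ^ 2 := by positivity
    linarith
  -- Summing `hrec` bounds `Z` by `(Z + T)/s + 2CB`; the boundary term at `m` is `T`, and `Z/s` is
  -- absorbed on the left.
  have hZS : Z ≤ S := by
    have h1 : Z ≤ ∑ k ∈ Finset.range m, (ζ ^ (k + 1) * D (k + 1) ^ 2 / s
        + C * (ζ ^ k * q k + ζ ^ (k + 1) * q (k + 1))) :=
      Finset.sum_le_sum fun k hk => hrec k (by have := Finset.mem_range.1 hk; omega)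
    rw [Finset.sum_add_distrib, ← Finset.sum_div, ← Finset.mul_sum, Finset.sum_add_distrib] at h1
    have h2 := hq0 m (by omega)
    have h3 := mul_le_mul_of_nonneg_left (add_le_add h2 hq1) hC0
    have h4 := div_le_div_of_nonneg_right hshift hs0.le
    have h5 : Z ≤ (Z + T) / s + C * (B + B) := by linarith
    have h6 := mul_le_mul_of_nonneg_right h5 hs0.le
    rw [add_mul, div_mul_cancel₀ _ hs0.ne'] at h6
    rw [hS, le_div_iff₀ hs1']
    linarith
  -- Averaging runs over `1, …, m`, not from `0`: the rerouting must happen after the first input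
  -- has been applied.
  have htotal : ∑ k ∈ Finset.range m, ζ ^ (k + 1) * (D (k + 1) ^ 2 + q (k + 1))
      ≤ ∑ k ∈ Finset.range m, (S + T + B + 1) / m := by
    rw [Finset.sum_const, Finset.card_range, nsmul_eq_mul, mul_div_cancel₀ _ (by positivity)]
    simp_rw [mul_add]
    rw [Finset.sum_add_distrib]
    linarith
  obtain ⟨k, hk, hle⟩ := Finset.exists_le_of_sum_le (Finset.nonempty_range_iff.2 (by omega)) htotal
  exact ⟨k + 1, by omega, by have := Finset.mem_range.1 hk; omega, hle⟩

/-! ### A practical Lyapunov criterion -/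

lemma isClassKL_mul_exp {c : ℝ} (hc : 0 < c) :
    IsClassKL fun r t => c * r * Real.exp (-t) := by
  refine ⟨by fun_prop, fun t _ => ⟨by fun_prop, by simp, fun a _ b _ hab => ?_⟩, fun r hr => ⟨?_, ?_⟩⟩
  · exact mul_lt_mul_of_pos_right (mul_lt_mul_of_pos_left hab hc) (Real.exp_pos _)
  · intro a _ b _ hab
    exact mul_lt_mul_of_pos_left (Real.exp_lt_exp.2 (neg_lt_neg hab)) (by positivity)
  · simpa using (Real.tendsto_exp_neg_atTop_nhds_zero).const_mul (c * r)

/-- Either `q > 2δ` and `V` drops by at least `δ`, or `V ≤ η` and one step leads to at most `η + δ`.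
Hence `{V ≤ η + δ}` is invariant and is entered within about `B / δ` steps. Starts within `r₀` are
already inside, and for the others the comparison function merely has to dominate `Dmax` up to the
entry time. -/
lemma practical_lyapunov {α : Type*} {F : α → α} {Y S : Set α} {V q d : α → ℝ}
    {δ η B ρ Dmax r₀ : ℝ} (hδ : 0 < δ) (hη : 0 ≤ η) (hr₀ : 0 < r₀) (hB : η + δ ≤ B)
    (hq0 : ∀ x ∈ Y, 0 ≤ q x)
    (hdesc : ∀ x ∈ Y, V x ≤ B → F x ∈ Y ∧ V (F x) ≤ V x - q x + δ)
    (hVq : ∀ x ∈ Y, q x ≤ 2 * δ → V x ≤ η)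
    (hρ : ∀ x ∈ Y, V x ≤ η + δ → d x ≤ ρ) (hD : ∀ x ∈ Y, d x ≤ Dmax)
    (hS : ∀ x ∈ S, x ∈ Y ∧ V x ≤ B) (hS₀ : ∀ x ∈ S, d x < r₀ → V x ≤ η + δ) :
    (∀ x ∈ S, ∀ k : ℕ, F^[k] x ∈ Y) ∧
      ∃ β, IsClassKL β ∧ ∀ x ∈ S, ∀ k : ℕ, d (F^[k] x) ≤ max (β (d x) k) ρ := by
  have hinv : ∀ L, η + δ ≤ L → L ≤ B → ∀ x ∈ Y, V x ≤ L → F x ∈ Y ∧ V (F x) ≤ L := by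
    intro L hL hLB x hx hVx
    obtain ⟨h1, h2⟩ := hdesc x hx (hVx.trans hLB)
    refine ⟨h1, ?_⟩
    rcases le_or_gt (q x) (2 * δ) with hq | hq
    · linarith [hVq x hx hq, hq0 x hx]
    · linarith
  have hiter : ∀ L, η + δ ≤ L → L ≤ B → ∀ x ∈ Y, V x ≤ L → ∀ k : ℕ,
      F^[k] x ∈ Y ∧ V (F^[k] x) ≤ L := by
    intro L hL hLB x hx hVx k
    induction k with
    | zero => exact ⟨hx, hVx⟩
    | succ k ih =>
      rw [Function.iterate_succ_apply']
      exact hinv L hL hLB _ ih.1 ih.2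
  have hdecr : ∀ x ∈ Y, V x ≤ B → ∀ k : ℕ, V (F^[k] x) ≤ max (η + δ) (B - k * δ) := by
    intro x hx hVx k
    induction k with
    | zero => simpa using Or.inr hVx
    | succ k ih =>
      obtain ⟨hy, hyB⟩ := hiter B hB le_rfl x hx hVx k
      rw [Function.iterate_succ_apply']
      rcases le_or_gt (V (F^[k] x)) (η + δ) with hle | hgt
      · exact le_max_of_le_left (hinv _ le_rfl hB _ hy hle).2
      · refine le_max_of_le_right ?_
        have h1 : V (F^[k] x) ≤ B - k * δ := by
          rcases le_max_iff.1 ih with h | h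
          · exact absurd h (not_le.2 hgt)
          · exact h
        have h2 : 2 * δ < q (F^[k] x) := by
          by_contra hq
          linarith [hVq _ hy (not_lt.1 hq)]
        have h3 := (hdesc _ hy hyB).2
        push_cast
        linarith
  obtain ⟨K, hK⟩ := exists_nat_gt (B / δ)
  rw [div_lt_iff₀ hδ] at hK
  -- With this slope, `c * r * exp (-k)` exceeds `Dmax` whenever `r ≥ r₀` and `k ≤ K`.
  have hc : 0 < (|Dmax| + 1) * Real.exp K / r₀ := by positivity
  refine ⟨fun x hx k => (hiter B hB le_rfl x (hS x hx).1 (hS x hx).2 k).1,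
    _, isClassKL_mul_exp hc, fun x hx k => ?_⟩
  obtain ⟨hxY, hxB⟩ := hS x hx
  rcases lt_or_ge (d x) r₀ with hlt | hge
  · obtain ⟨h1, h2⟩ := hiter _ le_rfl hB x hxY (hS₀ x hx hlt) k
    exact le_max_of_le_right (hρ _ h1 h2)
  obtain ⟨hy, hyB⟩ := hiter B hB le_rfl x hxY hxB k
  rcases le_or_gt K k with hKk | hKk
  · refine le_max_of_le_right (hρ _ hy ((hdecr x hxY hxB k).trans (max_le le_rfl ?_)))
    have : (K : ℝ) * δ ≤ k * δ := mul_le_mul_of_nonneg_right (by exact_mod_cast hKk) hδ.le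
    linarith
  · refine le_max_of_le_left ((hD _ hy).trans ?_)
    have h1 : 1 ≤ Real.exp K * Real.exp (-(k : ℝ)) := by
      rw [← Real.exp_add]
      refine Real.one_le_exp ?_
      have : (k : ℝ) ≤ K := by exact_mod_cast hKk.le
      linarith
    have h2 : 1 ≤ d x / r₀ := (one_le_div hr₀).2 hge
    calc Dmax ≤ |Dmax| + 1 := by linarith [le_abs_self Dmax]
      _ ≤ (|Dmax| + 1) * ((d x / r₀) * (Real.exp K * Real.exp (-(k : ℝ)))) :=
        le_mul_of_one_le_right (by positivity) (one_le_mul_of_one_le_of_one_le h2 h1)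
      _ = _ := by ring

section

/-! ### Distances and stage costs -/

variable {P : Vehicle} {W : Weights} {Ts : ℝ} {Rd : Mat3} {ue : Control} {X : Set State}
  {U : Set Control}

@[simp] lemma rot_hoverState (Rd : Mat3) : rot (hoverState Rd) = Rd := rfl

@[simp] lemma pos_hoverState (Rd : Mat3) : pos (hoverState Rd) = 0 := rfl

@[simp] lemma angVel_hoverState (Rd : Mat3) : angVel (hoverState Rd) = 0 := rfl

@[simp] lemma vel_hoverState (Rd : Mat3) : vel (hoverState Rd) = 0 := rfl

lemma stateDist_nonneg (x y : State) : 0 ≤ stateDist x y := Real.sqrt_nonneg _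

lemma stateDist_sq (x y : State) : stateDist x y ^ 2 = ‖rot x - rot y‖ ^ 2 + ‖pos x - pos y‖ ^ 2
    + ‖angVel x - angVel y‖ ^ 2 + ‖vel x - vel y‖ ^ 2 :=
  Real.sq_sqrt (by positivity)

lemma norm_sub_le_stateDist (x y : State) : ‖x - y‖ ≤ stateDist x y := by
  have h := stateDist_sq x y
  have h0 := stateDist_nonneg x y
  have key : ∀ a : ℝ, 0 ≤ a → a ^ 2 ≤ stateDist x y ^ 2 → a ≤ stateDist x y := fun a ha hle =>
    (abs_le_of_sq_le_sq' hle h0).2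
  have g1 := sq_nonneg ‖rot x - rot y‖
  have g2 := sq_nonneg ‖pos x - pos y‖
  have g3 := sq_nonneg ‖angVel x - angVel y‖
  have g4 := sq_nonneg ‖vel x - vel y‖
  refine max_le (key _ (norm_nonneg _) ?_) (max_le (key _ (norm_nonneg _) ?_)
    (max_le (key _ (norm_nonneg _) ?_) (key _ (norm_nonneg _) ?_)))
  · change ‖rot x - rot y‖ ^ 2 ≤ _; linarith
  · change ‖pos x - pos y‖ ^ 2 ≤ _; linarith
  · change ‖angVel x - angVel y‖ ^ 2 ≤ _; linarith
  · change ‖vel x - vel y‖ ^ 2 ≤ _; linarith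

lemma norm_components_le (x y : State) : ‖rot x - rot y‖ ≤ ‖x - y‖ ∧ ‖pos x - pos y‖ ≤ ‖x - y‖ ∧
    ‖angVel x - angVel y‖ ≤ ‖x - y‖ ∧ ‖vel x - vel y‖ ≤ ‖x - y‖ :=
  ⟨le_max_left _ _, (le_max_left _ _).trans (le_max_right _ _),
    ((le_max_left _ _).trans (le_max_right _ _)).trans (le_max_right _ _),
    ((le_max_right _ _).trans (le_max_right _ _)).trans (le_max_right _ _)⟩

lemma stateDist_sq_le (x y : State) : stateDist x y ^ 2 ≤ 4 * ‖x - y‖ ^ 2 := by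
  obtain ⟨h1, h2, h3, h4⟩ := norm_components_le x y
  rw [stateDist_sq]
  have g1 := pow_le_pow_left₀ (norm_nonneg _) h1 2
  have g2 := pow_le_pow_left₀ (norm_nonneg _) h2 2
  have g3 := pow_le_pow_left₀ (norm_nonneg _) h3 2
  have g4 := pow_le_pow_left₀ (norm_nonneg _) h4 2
  linarith

/-! ### Continuity, sign and size of the costs. -/

lemma continuous_act_right (w : Vec3) : Continuous fun R : Mat3 => act R w :=
  (actL.flip w).continuous

lemma continuous_stateCost (W : Weights) (Rd : Mat3) : Continuous (W.stateCost Rd) := by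
  have h1 : Continuous fun x : State => act (rot x) W.e₁ :=
    (continuous_act_right W.e₁).comp continuous_fst
  have h2 : Continuous fun x : State => act (rot x) W.e₂ :=
    (continuous_act_right W.e₂).comp continuous_fst
  have h : Continuous fun x : State => W.attErr (rot x) Rd :=
    (continuous_const.mul (continuous_const.mul ((h1.sub continuous_const).norm.pow 2))).add
      (continuous_const.mul (continuous_const.mul ((h2.sub continuous_const).norm.pow 2)))
  have h3 : Continuous fun x : State =>
    W.kp * ‖pos x‖ ^ 2 + W.kv * ‖vel x‖ ^ 2 + W.kω * ‖angVel x‖ ^ 2 := by fun_prop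
  exact h3.add (continuous_const.mul (h.pow 2))

lemma continuous_inputCost (W : Weights) (P : Vehicle) :
    Continuous fun p : State × Control => W.inputCost P p.1 p.2 :=
  (continuous_const.mul (P.contDiff_force.continuous.norm.pow 2)).add (by fun_prop)

lemma attErr_nonneg (W : Weights) (R Rd : Mat3) : 0 ≤ W.attErr R Rd := by
  have := W.k₁_pos; have := W.k₂_pos
  unfold Weights.attErr; positivity

lemma stateCost_nonneg (W : Weights) (Rd : Mat3) (x : State) : 0 ≤ W.stateCost Rd x := by
  have := W.kp_pos; have := W.kv_pos; have := W.kω_pos; have := W.kR_pos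
  unfold Weights.stateCost; positivity

lemma inputCost_nonneg (W : Weights) (P : Vehicle) (x : State) (u : Control) :
    0 ≤ W.inputCost P x u := by
  have := W.kf_pos; have := W.kτ_pos
  unfold Weights.inputCost; positivity

lemma stateCost_hoverState (W : Weights) (Rd : Mat3) : W.stateCost Rd (hoverState Rd) = 0 := by
  rw [Weights.stateCost, rot_hoverState, pos_hoverState, angVel_hoverState, vel_hoverState]
  simp [Weights.attErr]

lemma Vehicle.IsHover.inputCost_eq_zero (h : P.IsHover Rd ue) (W : Weights) :
    W.inputCost P (hoverState Rd) ue = 0 := by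
  simp [Weights.inputCost, h.force_eq_zero, h.torque_eq]

lemma exists_stateDist_le (hXc : IsCompact X) (Rd : Mat3) :
    ∃ Dm : ℝ, 0 < Dm ∧ ∀ x ∈ X, stateDist x (hoverState Rd) ≤ Dm := by
  obtain ⟨r, hr⟩ := hXc.isBounded.subset_closedBall (hoverState Rd)
  refine ⟨2 * |r| + 1, by positivity, fun x hx => ?_⟩
  have h1 : ‖x - hoverState Rd‖ ≤ |r| := (mem_closedBall_iff_norm.1 (hr hx)).trans (le_abs_self r)
  have h2 := stateDist_sq_le x (hoverState Rd)
  have h3 := pow_le_pow_left₀ (norm_nonneg _) h1 2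
  refine (abs_le_of_sq_le_sq' ?_ (by positivity)).2
  nlinarith [abs_nonneg r]

/-- The attitude term is of fourth order; compactness turns two of the four powers into a constant.
-/
lemma exists_stateCost_le (hXc : IsCompact X) (W : Weights) (Rd : Mat3) :
    ∃ c : ℝ, 0 ≤ c ∧ ∀ x ∈ X, W.stateCost Rd x ≤ c * stateDist x (hoverState Rd) ^ 2 := by
  obtain ⟨Dm, hDm, hD⟩ := exists_stateDist_le hXc Rd
  have hp := W.kp_pos; have hv := W.kv_pos; have hω := W.kω_pos; have hR := W.kR_pos
  have h₁ := W.k₁_pos; have h₂ := W.k₂_pos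
  set a : ℝ := (W.k₁ + W.k₂) * ‖actL‖ ^ 2 with ha
  refine ⟨W.kp + W.kv + W.kω + W.kR * (a ^ 2 * Dm ^ 2), by positivity, fun x hx => ?_⟩
  set d := stateDist x (hoverState Rd) with hd
  have hd0 : 0 ≤ d := stateDist_nonneg _ _
  obtain ⟨n1, n2, n3, n4⟩ := norm_components_le x (hoverState Rd)
  have hnd := norm_sub_le_stateDist x (hoverState Rd)
  have g1 : ‖rot x - Rd‖ ^ 2 ≤ d ^ 2 := pow_le_pow_left₀ (norm_nonneg _) (n1.trans hnd) 2
  have g2 : ‖pos x‖ ^ 2 ≤ d ^ 2 := by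
    have := pow_le_pow_left₀ (norm_nonneg _) (n2.trans hnd) 2
    rwa [pos_hoverState, sub_zero] at this
  have g3 : ‖angVel x‖ ^ 2 ≤ d ^ 2 := by
    have := pow_le_pow_left₀ (norm_nonneg _) (n3.trans hnd) 2
    rwa [angVel_hoverState, sub_zero] at this
  have g4 : ‖vel x‖ ^ 2 ≤ d ^ 2 := by
    have := pow_le_pow_left₀ (norm_nonneg _) (n4.trans hnd) 2
    rwa [vel_hoverState, sub_zero] at this
  have hact : ∀ w : Vec3, ‖w‖ = 1 → ‖act (rot x) w - act Rd w‖ ^ 2 ≤ ‖actL‖ ^ 2 * d ^ 2 := by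
    intro w hw
    have e : act (rot x) w - act Rd w = act (rot x - Rd) w := by
      rw [← actL_apply, ← actL_apply, ← actL_apply, map_sub]; rfl
    have := norm_act_le (rot x - Rd) w
    rw [hw, mul_one] at this
    rw [e]
    calc _ ≤ (‖actL‖ * ‖rot x - Rd‖) ^ 2 := pow_le_pow_left₀ (norm_nonneg _) this 2
      _ = ‖actL‖ ^ 2 * ‖rot x - Rd‖ ^ 2 := by ring
      _ ≤ _ := mul_le_mul_of_nonneg_left g1 (by positivity)
  have hatt : W.attErr (rot x) Rd ≤ a * d ^ 2 := by
    have e1 := mul_le_mul_of_nonneg_left (hact _ W.e₁_unit) h₁.le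
    have e2 := mul_le_mul_of_nonneg_left (hact _ W.e₂_unit) h₂.le
    have e3 : 0 ≤ W.k₁ * (‖actL‖ ^ 2 * d ^ 2) := by positivity
    have e4 : 0 ≤ W.k₂ * (‖actL‖ ^ 2 * d ^ 2) := by positivity
    simp only [Weights.attErr, ha]
    linarith
  have hatt2 : W.attErr (rot x) Rd ^ 2 ≤ a ^ 2 * Dm ^ 2 * d ^ 2 := by
    calc W.attErr (rot x) Rd ^ 2 ≤ (a * d ^ 2) ^ 2 := pow_le_pow_left₀ (attErr_nonneg _ _ _) hatt 2
      _ = a ^ 2 * d ^ 2 * d ^ 2 := by ring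
      _ ≤ a ^ 2 * Dm ^ 2 * d ^ 2 := by
        have := pow_le_pow_left₀ hd0 (hD x hx) 2
        gcongr
  have f1 := mul_le_mul_of_nonneg_left g2 hp.le
  have f2 := mul_le_mul_of_nonneg_left g4 hv.le
  have f3 := mul_le_mul_of_nonneg_left g3 hω.le
  have f4 := mul_le_mul_of_nonneg_left hatt2 hR.le
  simp only [Weights.stateCost]
  linarith

/-- The state cost controls the squares of the linear components and the fourth power of the
attitude error. -/
lemma exists_le_stateCost (hXc : IsCompact X) (hXT : X ⊆ TSE3) (W : Weights) (hRd : Rd ∈ SO3) :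
    ∃ c : ℝ, 0 < c ∧ ∀ x ∈ X, ‖angVel x‖ ^ 2 ≤ c * W.stateCost Rd x ∧
      ‖rot x - Rd‖ ^ 4 ≤ c * W.stateCost Rd x ∧
      stateDist x (hoverState Rd) ^ 2 ≤ ‖rot x - Rd‖ ^ 2 + c * W.stateCost Rd x ∧
      stateDist x (hoverState Rd) ^ 4 ≤ c * W.stateCost Rd x := by
  obtain ⟨Dm, hDm, hD⟩ := exists_stateDist_le hXc Rd
  obtain ⟨C, hC, hatt⟩ := W.exists_norm_sub_sq_le_attErr hRd
  have hp := W.kp_pos; have hv := W.kv_pos; have hω := W.kω_pos; have hR := W.kR_pos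
  set b : ℝ := W.kp⁻¹ + W.kv⁻¹ + W.kω⁻¹ with hb
  set a : ℝ := C ^ 2 * W.kR⁻¹ with ha
  have hb0 : 0 < b := by positivity
  have ha0 : 0 < a := by positivity
  refine ⟨b + a + 2 * (a + b * Dm ^ 2), by positivity, fun x hx => ?_⟩
  set Q := W.stateCost Rd x with hQ
  have hQ0 : 0 ≤ Q := stateCost_nonneg _ _ _
  have t1 : 0 ≤ W.kp * ‖pos x‖ ^ 2 := by positivity
  have t2 : 0 ≤ W.kv * ‖vel x‖ ^ 2 := by positivity
  have t3 : 0 ≤ W.kω * ‖angVel x‖ ^ 2 := by positivity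
  have t4 : 0 ≤ W.kR * W.attErr (rot x) Rd ^ 2 := by positivity
  have hQeq : Q = W.kp * ‖pos x‖ ^ 2 + W.kv * ‖vel x‖ ^ 2 + W.kω * ‖angVel x‖ ^ 2
    + W.kR * W.attErr (rot x) Rd ^ 2 := rfl
  have s1 : ‖pos x‖ ^ 2 ≤ W.kp⁻¹ * Q := by rw [le_inv_mul_iff₀ hp]; linarith
  have s2 : ‖vel x‖ ^ 2 ≤ W.kv⁻¹ * Q := by rw [le_inv_mul_iff₀ hv]; linarith
  have s3 : ‖angVel x‖ ^ 2 ≤ W.kω⁻¹ * Q := by rw [le_inv_mul_iff₀ hω]; linarith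
  have s4 : W.attErr (rot x) Rd ^ 2 ≤ W.kR⁻¹ * Q := by rw [le_inv_mul_iff₀ hR]; linarith
  have s5 : ‖rot x - Rd‖ ^ 4 ≤ a * Q := by
    have h1 := pow_le_pow_left₀ (by positivity) (hatt (rot x) (hXT hx)) 2
    calc ‖rot x - Rd‖ ^ 4 = (‖rot x - Rd‖ ^ 2) ^ 2 := by ring
      _ ≤ (C * W.attErr (rot x) Rd) ^ 2 := h1
      _ = C ^ 2 * W.attErr (rot x) Rd ^ 2 := by ring
      _ ≤ C ^ 2 * (W.kR⁻¹ * Q) := mul_le_mul_of_nonneg_left s4 (by positivity)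
      _ = a * Q := by rw [ha]; ring
  have s6 : ‖pos x‖ ^ 2 + ‖angVel x‖ ^ 2 + ‖vel x‖ ^ 2 ≤ b * Q := by
    rw [hb, add_mul, add_mul]; linarith
  have hdsq : stateDist x (hoverState Rd) ^ 2
      = ‖rot x - Rd‖ ^ 2 + (‖pos x‖ ^ 2 + ‖angVel x‖ ^ 2 + ‖vel x‖ ^ 2) := by
    rw [stateDist_sq, rot_hoverState, pos_hoverState, angVel_hoverState, vel_hoverState, sub_zero,
      sub_zero, sub_zero]
    ring
  have p1 : 0 ≤ b * Q := by positivity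
  have p2 : 0 ≤ a * Q := by positivity
  have p3 : 0 ≤ (a + b * Dm ^ 2) * Q := by positivity
  have p4 : 0 ≤ W.kp⁻¹ * Q := by positivity
  have p5 : 0 ≤ W.kv⁻¹ * Q := by positivity
  refine ⟨?_, ?_, ?_, ?_⟩
  · have : b * Q = W.kp⁻¹ * Q + W.kv⁻¹ * Q + W.kω⁻¹ * Q := by rw [hb]; ring
    linarith
  · linarith
  · rw [hdsq]; linarith
  · set z := ‖pos x‖ ^ 2 + ‖angVel x‖ ^ 2 + ‖vel x‖ ^ 2 with hz
    have hz0 : 0 ≤ z := by positivity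
    have hzD : z ≤ Dm ^ 2 := by
      have := pow_le_pow_left₀ (stateDist_nonneg _ _) (hD x hx) 2
      rw [hdsq] at this
      linarith [sq_nonneg ‖rot x - Rd‖]
    have h1 : z ^ 2 ≤ b * Dm ^ 2 * Q := by
      calc z ^ 2 = z * z := sq z
        _ ≤ Dm ^ 2 * (b * Q) := mul_le_mul hzD s6 hz0 (by positivity)
        _ = _ := by ring
    calc stateDist x (hoverState Rd) ^ 4 = (stateDist x (hoverState Rd) ^ 2) ^ 2 := by ring
      _ = (‖rot x - Rd‖ ^ 2 + z) ^ 2 := by rw [hdsq]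
      _ ≤ 2 * ((‖rot x - Rd‖ ^ 2) ^ 2 + z ^ 2) := add_sq_le
      _ = 2 * (‖rot x - Rd‖ ^ 4 + z ^ 2) := by ring
      _ ≤ _ := by linarith

/-- The attitude changes slowly when the angular velocities are small. -/
lemma exists_norm_rot_step_sub_le (P : Vehicle) (Ts : ℝ) :
    ∃ c : ℝ, 0 ≤ c ∧ ∀ x ∈ TSE3, ∀ u, ‖rot (P.step Ts x u) - rot x‖
      ≤ c * (‖angVel x‖ + ‖angVel (P.step Ts x u)‖) := by
  obtain ⟨C, hC, hcay⟩ := exists_norm_cay_sub_one_le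
  refine ⟨Real.sqrt 3 * (C * (|Ts| * 2⁻¹)), by positivity, fun x hx u => ?_⟩
  set μ := P.midAngVel Ts x u with hμ
  -- Eliminating the torque exhibits the intermediate angular velocity as the mean of two
  -- consecutive ones, so no bound on the input enters.
  have hmid : μ = (2⁻¹ : ℝ) • (angVel x + angVel (P.step Ts x u)) := by
    change μ = (2⁻¹ : ℝ) • (angVel x + (μ + (Ts / 2) • act P.inertia⁻¹ (P.torque x u)))
    have h1 : μ = angVel x + (Ts / 2) • act P.inertia⁻¹ (P.torque x u) := rfl
    have h2 : (Ts / 2) • act P.inertia⁻¹ (P.torque x u) = μ - angVel x := by rw [h1]; abel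
    rw [h2]; module
  have hrot : rot (P.step Ts x u) - rot x = rot x * (cay (Ts • μ) - 1) := by
    rw [mul_sub, mul_one]; rfl
  have h1 : ‖rot x * (cay (Ts • μ) - 1)‖ ≤ Real.sqrt 3 * ‖cay (Ts • μ) - 1‖ := by
    have := norm_mul_le (rot x) (cay (Ts • μ) - 1)
    rwa [norm_of_mem_SO3 hx] at this
  have h2 : ‖Ts • μ‖ ≤ |Ts| * (2⁻¹ * (‖angVel x‖ + ‖angVel (P.step Ts x u)‖)) := by
    rw [norm_smul, Real.norm_eq_abs, hmid, norm_smul]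
    have := norm_add_le (angVel x) (angVel (P.step Ts x u))
    rw [Real.norm_of_nonneg (by norm_num : (0 : ℝ) ≤ 2⁻¹)]
    gcongr
  rw [hrot]
  calc _ ≤ Real.sqrt 3 * ‖cay (Ts • μ) - 1‖ := h1
    _ ≤ Real.sqrt 3 * (C * (|Ts| * (2⁻¹ * (‖angVel x‖ + ‖angVel (P.step Ts x u)‖)))) := by
      gcongr
      exact (hcay _).trans (mul_le_mul_of_nonneg_left h2 hC)
    _ = _ := by ring

/-! ### Admissible input sequences -/

lemma traj_congr {x : State} {u w : ℕ → Control} {k : ℕ} (h : ∀ i < k, u i = w i) :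
    P.traj Ts x u k = P.traj Ts x w k := by
  induction k with
  | zero => rfl
  | succ k ih =>
    rw [Vehicle.traj, Vehicle.traj, ih fun i hi => h i (hi.trans (Nat.lt_succ_self k)),
      h k (Nat.lt_succ_self k)]

lemma traj_add (x : State) (u : ℕ → Control) (k i : ℕ) :
    P.traj Ts x u (k + i) = P.traj Ts (P.traj Ts x u k) (fun j => u (k + j)) i := by
  induction i with
  | zero => rfl
  | succ i ih => rw [← add_assoc, Vehicle.traj, ih, Vehicle.traj]

lemma continuous_traj (P : Vehicle) (Ts : ℝ) (x : State) (j : ℕ) :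
    Continuous fun u : ℕ → Control => P.traj Ts x u j := by
  induction j with
  | zero => exact continuous_const
  | succ j ih =>
    exact (P.contDiff_step Ts).continuous.comp (ih.prodMk (continuous_apply j))

lemma continuous_cost (P : Vehicle) (W : Weights) (Rd : Mat3) (Ts : ℝ) (N : ℕ) (x : State) :
    Continuous (cost P W Rd Ts N x) := by
  have h1 : ∀ j, Continuous fun u : ℕ → Control => W.stateCost Rd (P.traj Ts x u j) := fun j =>
    (continuous_stateCost W Rd).comp (continuous_traj P Ts x j)
  have h2 : ∀ j, Continuous fun u : ℕ → Control => W.inputCost P (P.traj Ts x u j) (u j) := by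
    intro j
    have h3 : Continuous fun u : ℕ → Control => (P.traj Ts x u j, u j) :=
      (continuous_traj P Ts x j).prodMk (continuous_apply j)
    have h4 := (continuous_inputCost W P).comp h3
    exact h4
  unfold cost
  fun_prop

lemma cost_congr {N : ℕ} {x : State} {u w : ℕ → Control} (h : ∀ i ≤ N, u i = w i) :
    cost P W Rd Ts N x u = cost P W Rd Ts N x w := by
  refine Finset.sum_congr rfl fun j hj => ?_
  have hj' : j ≤ N := Nat.lt_succ_iff.1 (Finset.mem_range.1 hj)
  rw [traj_congr (fun i hi => h i (hi.le.trans hj')), h j hj']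

lemma Admissible.congr {N : ℕ} {x : State} {u w : ℕ → Control}
    (hu : Admissible P Ts X U N x u) (h : ∀ i ≤ N, u i = w i) : Admissible P Ts X U N x w := by
  intro j hj
  rw [← traj_congr (fun i hi => h i (hi.le.trans hj)), ← h j hj]
  exact hu j hj

/-- Input sequences in `U` form a compact product on which cost and constraints are continuous.
Inputs after time `N` are unconstrained, so each competitor is frozen at its value at `N` to lie in
the product. -/
theorem exists_isOptimal (hXc : IsCompact X) (hUc : IsCompact U) (W : Weights) (Rd : Mat3) {N : ℕ}
    {x : State} (hx : Feasible P Ts X U N x) : ∃ u, IsOptimal P W Rd Ts X U N x u := by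
  let A : Set (ℕ → Control) :=
    Set.univ.pi (fun _ => U) ∩ ⋂ j ∈ Set.Iic N, {u | P.traj Ts x u j ∈ X}
  have hA : IsCompact A := (isCompact_univ_pi fun _ => hUc).inter_right
    (isClosed_biInter fun j _ => hXc.isClosed.preimage (continuous_traj P Ts x j))
  have hmem : ∀ w, Admissible P Ts X U N x w → (fun j => w (min j N)) ∈ A := by
    intro w hw
    have hw' : Admissible P Ts X U N x fun j => w (min j N) :=
      hw.congr fun i hi => by rw [min_eq_left hi]
    exact ⟨fun j _ => (hw _ (min_le_right _ _)).2, Set.mem_iInter₂.2 fun j hj => (hw' j hj).1⟩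
  have hadm : ∀ w ∈ A, Admissible P Ts X U N x w := fun w hw j hj =>
    ⟨Set.mem_iInter₂.1 hw.2 j hj, hw.1 j trivial⟩
  obtain ⟨w, hw⟩ := hx
  obtain ⟨u, huA, hmin⟩ := hA.exists_isMinOn ⟨_, hmem w hw⟩
    (continuous_cost P W Rd Ts N x).continuousOn
  refine ⟨u, hadm u huA, fun v hv => ?_⟩
  rw [cost_congr (u := v) (w := fun j => v (min j N)) fun i hi => by simp [min_eq_left hi]]
  exact isMinOn_iff.1 hmin _ (hmem v hv)

/-- States of `X` within `ε` of the equilibrium are steered into it in four steps, within the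
constraints and at a linear cost. -/
def LocallySteerable (P : Vehicle) (Ts : ℝ) (X : Set State) (U : Set Control) (Rd : Mat3)
    (ue : Control) (ε C : ℝ) : Prop :=
  ∀ x ∈ X, stateDist x (hoverState Rd) < ε → ∃ u : ℕ → Control, ∀ i,
    P.traj Ts x u i ∈ X ∧ u i ∈ U ∧
    stateDist (P.traj Ts x u i) (hoverState Rd) ≤ C * stateDist x (hoverState Rd) ∧
    ‖u i - ue‖ ≤ C * stateDist x (hoverState Rd) ∧
    ‖P.force (P.traj Ts x u i) (u i)‖ ≤ C * stateDist x (hoverState Rd) ∧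
    (4 ≤ i → P.traj Ts x u i = hoverState Rd ∧ u i = ue)

theorem Vehicle.IsHover.exists_locallySteerable (h : P.IsHover Rd ue) (hTs : 0 < Ts) (hTs1 : Ts ≤ 1)
    (hTs2 : Ts * ‖P.forceDeriv‖ < 2 * P.mass) (hXT : X ⊆ TSE3) (hX : X ∈ 𝓝[TSE3] (hoverState Rd))
    (hU : U ∈ 𝓝 ue) : ∃ ε C : ℝ, 0 < ε ∧ 0 < C ∧ LocallySteerable P Ts X U Rd ue ε C := by
  obtain ⟨C, hC, r, hr, hst⟩ := h.exists_steering hTs hTs1 hTs2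
  obtain ⟨δ, hδ, hδX⟩ := Metric.mem_nhdsWithin_iff.1 hX
  obtain ⟨δ', hδ', hδU⟩ := Metric.mem_nhds_iff.1 hU
  -- The radius keeps the whole steering within the neighbourhoods in `X` and `U`; the factor `2`
  -- converts the maximum norm to `stateDist`.
  refine ⟨min r (min (δ / C) (δ' / C)), 2 * C, by positivity, by positivity, fun x hx hxε => ?_⟩
  have hn := norm_sub_le_stateDist x (hoverState Rd)
  have hd0 := stateDist_nonneg x (hoverState Rd)
  have e1 : stateDist x (hoverState Rd) < r := hxε.trans_le (min_le_left _ _)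
  have e2 : stateDist x (hoverState Rd) < δ / C :=
    hxε.trans_le ((min_le_right _ _).trans (min_le_left _ _))
  have e3 : stateDist x (hoverState Rd) < δ' / C :=
    hxε.trans_le ((min_le_right _ _).trans (min_le_right _ _))
  rw [lt_div_iff₀ hC] at e2 e3
  obtain ⟨u, hu⟩ := hst x (hXT hx) (hn.trans_lt e1)
  refine ⟨u, fun i => ?_⟩
  obtain ⟨h1, h2, h3, h4⟩ := hu i
  have hCn : C * ‖x - hoverState Rd‖ ≤ C * stateDist x (hoverState Rd) :=
    mul_le_mul_of_nonneg_left hn hC.le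
  have hCd : 0 ≤ C * stateDist x (hoverState Rd) := by positivity
  refine ⟨hδX ⟨?_, traj_mem_TSE3 (hXT hx) u i⟩, hδU ?_, ?_, by linarith, by linarith, h4⟩
  · rw [mem_ball_iff_norm]; linarith
  · rw [mem_ball_iff_norm]; linarith
  · refine (abs_le_of_sq_le_sq' ?_ (by positivity)).2
    calc _ ≤ 4 * ‖P.traj Ts x u i - hoverState Rd‖ ^ 2 := stateDist_sq_le _ _
      _ ≤ 4 * (C * stateDist x (hoverState Rd)) ^ 2 := by
        have := pow_le_pow_left₀ (norm_nonneg _) (h1.trans hCn) 2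
        linarith
      _ = _ := by ring

end

section

/-! ### The value function -/

variable {P : Vehicle} {W : Weights} {Ts : ℝ} {Rd : Mat3} {ue : Control} {X : Set State}
  {U : Set Control}

lemma stageCost_nonneg (P : Vehicle) (W : Weights) (Rd : Mat3) (j : ℕ) (x : State) (u : Control) :
    0 ≤ W.ζ ^ j * W.stateCost Rd x + W.inputCost P x u :=
  add_nonneg (mul_nonneg (pow_nonneg (one_pos.trans W.one_lt_ζ).le _) (stateCost_nonneg _ _ _))
    (inputCost_nonneg _ _ _ _)

lemma sum_range_le_cost {N k : ℕ} (hk : k ≤ N + 1) (x : State) (u : ℕ → Control) :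
    ∑ j ∈ Finset.range k, (W.ζ ^ j * W.stateCost Rd (P.traj Ts x u j)
      + W.inputCost P (P.traj Ts x u j) (u j)) ≤ cost P W Rd Ts N x u :=
  Finset.sum_le_sum_of_subset_of_nonneg (Finset.range_mono hk) fun _ _ _ =>
    stageCost_nonneg _ _ _ _ _ _

lemma stateCost_add_inputCost_le_cost (N : ℕ) (x : State) (u : ℕ → Control) :
    W.stateCost Rd x + W.inputCost P x (u 0) ≤ cost P W Rd Ts N x u := by
  have h := sum_range_le_cost (P := P) (W := W) (Rd := Rd) (Ts := Ts) (by omega : 1 ≤ N + 1) x u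
  simpa [Vehicle.traj] using h

lemma cost_nonneg (N : ℕ) (x : State) (u : ℕ → Control) : 0 ≤ cost P W Rd Ts N x u :=
  Finset.sum_nonneg fun _ _ => stageCost_nonneg _ _ _ _ _ _

/-- The optimal value of the optimal control problem. -/
def valueFn (P : Vehicle) (W : Weights) (Rd : Mat3) (Ts : ℝ) (X : Set State) (U : Set Control)
    (N : ℕ) (x : State) : ℝ :=
  sInf (cost P W Rd Ts N x '' {u | Admissible P Ts X U N x u})

lemma IsOptimal.valueFn_eq {N : ℕ} {x : State} {u : ℕ → Control}
    (hu : IsOptimal P W Rd Ts X U N x u) : valueFn P W Rd Ts X U N x = cost P W Rd Ts N x u :=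
  IsLeast.csInf_eq ⟨⟨u, hu.1, rfl⟩, by rintro _ ⟨w, hw, rfl⟩; exact hu.2 w hw⟩

lemma Admissible.valueFn_le {N : ℕ} {x : State} {u : ℕ → Control}
    (hu : Admissible P Ts X U N x u) : valueFn P W Rd Ts X U N x ≤ cost P W Rd Ts N x u :=
  csInf_le ⟨0, by rintro _ ⟨w, _, rfl⟩; exact cost_nonneg _ _ _⟩ ⟨u, hu, rfl⟩

/-- A feasible sequence that reaches a neighbourhood of the equilibrium extends to any horizon, at
a cost that is quadratic in the distance to the equilibrium. -/
theorem LocallySteerable.exists_admissible {ε C : ℝ} (hst : LocallySteerable P Ts X U Rd ue ε C)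
    (h : P.IsHover Rd ue) (hXc : IsCompact X) (W : Weights) :
    ∃ K : ℝ, 0 < K ∧ ∀ (x : State) (u : ℕ → Control) (k : ℕ),
      (∀ i ≤ k, P.traj Ts x u i ∈ X) → (∀ i < k, u i ∈ U) →
      stateDist (P.traj Ts x u k) (hoverState Rd) < ε → ∀ N : ℕ,
      ∃ w, Admissible P Ts X U N x w ∧ cost P W Rd Ts N x w ≤
        ∑ j ∈ Finset.range k, (W.ζ ^ j * W.stateCost Rd (P.traj Ts x u j)
          + W.inputCost P (P.traj Ts x u j) (u j))
        + K * (W.ζ ^ k * stateDist (P.traj Ts x u k) (hoverState Rd) ^ 2) := by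
  obtain ⟨c, hc, hcost⟩ := exists_stateCost_le hXc W Rd
  have hf := W.kf_pos
  have hτ := W.kτ_pos
  have hζ := W.one_lt_ζ
  have hζ0 : 0 < W.ζ := one_pos.trans hζ
  set K₀ : ℝ := c * C ^ 2 + W.kf * C ^ 2 + W.kτ * C ^ 2 with hK₀
  have hK₀0 : 0 ≤ K₀ := by positivity
  -- Only four stages after time `k` are nonzero, each with weight at most `ζ^(k+4)`; the `+ 1`
  -- ensures positivity.
  refine ⟨4 * (W.ζ ^ 4 * K₀) + 1, by positivity, fun x u k hX hU hk N => ?_⟩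
  obtain ⟨v, hv⟩ := hst _ (hX k le_rfl) hk
  set y := P.traj Ts x u k with hy
  set d := stateDist y (hoverState Rd) with hd
  have hd0 : 0 ≤ d := stateDist_nonneg _ _
  let w : ℕ → Control := fun j => if j < k then u j else v (j - k)
  have hw₁ : ∀ j < k, w j = u j := fun j hj => if_pos hj
  have hw₂ : ∀ i, w (k + i) = v i := fun i => by simp [w]
  have ht₁ : ∀ j ≤ k, P.traj Ts x w j = P.traj Ts x u j := fun j hj =>
    traj_congr fun i hi => hw₁ i (hi.trans_le hj)
  have ht₂ : ∀ i, P.traj Ts x w (k + i) = P.traj Ts y v i := fun i => by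
    rw [traj_add, ht₁ k le_rfl]; simp only [hw₂]; rfl
  refine ⟨w, fun j _ => ?_, ?_⟩
  · rcases lt_or_ge j k with hj | hj
    · rw [ht₁ j hj.le, hw₁ j hj]; exact ⟨hX j hj.le, hU j hj⟩
    · obtain ⟨i, rfl⟩ := Nat.exists_eq_add_of_le hj
      rw [ht₂, hw₂]; exact ⟨(hv i).1, (hv i).2.1⟩
  · have hstage : ∀ i < 4, W.ζ ^ (k + i) * W.stateCost Rd (P.traj Ts y v i)
        + W.inputCost P (P.traj Ts y v i) (v i) ≤ W.ζ ^ 4 * K₀ * (W.ζ ^ k * d ^ 2) := by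
      intro i hi
      obtain ⟨g1, -, g2, g3, g4, -⟩ := hv i
      have e1 : W.stateCost Rd (P.traj Ts y v i) ≤ c * (C * d) ^ 2 :=
        (hcost _ g1).trans (mul_le_mul_of_nonneg_left
          (pow_le_pow_left₀ (stateDist_nonneg _ _) g2 2) hc)
      have e2 : ‖(v i).2‖ ≤ C * d := by
        have := norm_snd_le (v i - ue)
        rw [Prod.snd_sub, h.torque_eq, sub_zero] at this
        exact this.trans g3
      have e3 : W.inputCost P (P.traj Ts y v i) (v i)
          ≤ W.kf * (C * d) ^ 2 + W.kτ * (C * d) ^ 2 :=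
        add_le_add
          (mul_le_mul_of_nonneg_left (pow_le_pow_left₀ (norm_nonneg _) g4 2) hf.le)
          (mul_le_mul_of_nonneg_left (pow_le_pow_left₀ (norm_nonneg _) e2 2) hτ.le)
      have e4 : 1 ≤ W.ζ ^ (k + i) := one_le_pow₀ hζ.le
      have e5 : W.ζ ^ (k + i) ≤ W.ζ ^ (k + 4) := pow_le_pow_right₀ hζ.le (by omega)
      have e6 : 0 ≤ K₀ * d ^ 2 := by positivity
      calc _ ≤ W.ζ ^ (k + i) * W.stateCost Rd (P.traj Ts y v i)
            + W.ζ ^ (k + i) * W.inputCost P (P.traj Ts y v i) (v i) :=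
            add_le_add le_rfl (le_mul_of_one_le_left (inputCost_nonneg _ _ _ _) e4)
        _ = W.ζ ^ (k + i) * (W.stateCost Rd (P.traj Ts y v i)
            + W.inputCost P (P.traj Ts y v i) (v i)) := by ring
        _ ≤ W.ζ ^ (k + i) * (K₀ * d ^ 2) := by
          refine mul_le_mul_of_nonneg_left ?_ (by positivity)
          calc _ ≤ c * (C * d) ^ 2 + (W.kf * (C * d) ^ 2 + W.kτ * (C * d) ^ 2) := add_le_add e1 e3
            _ = K₀ * d ^ 2 := by rw [hK₀]; ring
        _ ≤ W.ζ ^ (k + 4) * (K₀ * d ^ 2) := mul_le_mul_of_nonneg_right e5 e6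
        _ = _ := by ring
    have hzero : ∀ i, 4 ≤ i → W.ζ ^ (k + i) * W.stateCost Rd (P.traj Ts y v i)
        + W.inputCost P (P.traj Ts y v i) (v i) = 0 := by
      intro i hi
      obtain ⟨g1, g2⟩ := (hv i).2.2.2.2.2 hi
      rw [g1, g2, stateCost_hoverState, h.inputCost_eq_zero]
      simp
    -- The horizon may end before or after the steering; as stages are nonnegative, the sum can be
    -- extended past both.
    have hsum := sum_range_le_cost (P := P) (W := W) (Rd := Rd) (Ts := Ts)
      (by omega : N + 1 ≤ (k + (4 + N)) + 1) x w
    have hcostle : cost P W Rd Ts N x w ≤ ∑ j ∈ Finset.range (k + (4 + (N + 1))),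
        (W.ζ ^ j * W.stateCost Rd (P.traj Ts x w j) + W.inputCost P (P.traj Ts x w j) (w j)) :=
      hsum
    refine hcostle.trans ?_
    rw [Finset.sum_range_add]
    refine add_le_add (le_of_eq (Finset.sum_congr rfl fun j hj => ?_)) ?_
    · have hj' := Finset.mem_range.1 hj
      rw [ht₁ j hj'.le, hw₁ j hj']
    · simp only [ht₂, hw₂]
      rw [Finset.sum_range_add, Finset.sum_eq_zero (s := Finset.range (N + 1))
        fun i _ => hzero (4 + i) (by omega), add_zero]
      have hle := Finset.sum_le_card_nsmul (Finset.range 4) _ _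
        fun i hi => hstage i (Finset.mem_range.1 hi)
      rw [Finset.card_range, nsmul_eq_mul] at hle
      refine hle.trans ?_
      have : 0 ≤ W.ζ ^ k * d ^ 2 := by positivity
      push_cast
      linarith

/-- The shifted optimal sequence, rerouted to the equilibrium at a suitable time, decreases the
value by the state cost, up to an error of order `1 / m`. -/
theorem LocallySteerable.exists_descent {ε C : ℝ} (hst : LocallySteerable P Ts X U Rd ue ε C)
    (h : P.IsHover Rd ue) (hε : 0 < ε) (hXc : IsCompact X) (hXT : X ⊆ TSE3) (W : Weights) {B : ℝ}
    (hB : 0 ≤ B) :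
    ∃ K : ℝ, 0 < K ∧ ∀ N m : ℕ, 1 ≤ m → 2 * m ≤ N → K / m < ε ^ 2 → ∀ (x : State) (u : ℕ → Control),
      Admissible P Ts X U N x u → cost P W Rd Ts N x u ≤ B →
      ∃ w, Admissible P Ts X U N (P.step Ts x (u 0)) w ∧
        cost P W Rd Ts N (P.step Ts x (u 0)) w
          ≤ cost P W Rd Ts N x u - W.stateCost Rd x + K / m := by
  obtain ⟨c₁, hc₁, hcost⟩ := exists_le_stateCost hXc hXT W h.rot_mem
  obtain ⟨c₂, hc₂, hrot⟩ := exists_norm_rot_step_sub_le P Ts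
  obtain ⟨C₁, hC₁, hreach⟩ := hst.exists_admissible h hXc W
  obtain ⟨K, hK, hsmall⟩ := exists_small_weighted W.one_lt_ζ (add_nonneg hc₁.le hc₂) hB
  have hζ := W.one_lt_ζ
  have hζ0 : 0 < W.ζ := one_pos.trans hζ
  -- `(1 + c₁) K / m` bounds `ζ^k d²` and `C₁` times it the rerouting cost. The extra summand makes
  -- the hypothesis on `ε` imply `d < ε`.
  refine ⟨(1 + C₁) * ((1 + c₁) * K), by positivity, fun N m hm hmN hKε x u hu huB => ?_⟩
  have hmem : ∀ j ≤ N, P.traj Ts x u j ∈ X := fun j hj => (hu j hj).1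
  have hq0 : ∀ j, 0 ≤ W.stateCost Rd (P.traj Ts x u j) := fun j => stateCost_nonneg _ _ _
  obtain ⟨k, hk1, hkm, hk⟩ := hsmall N m hm hmN (fun j => ‖rot (P.traj Ts x u j) - Rd‖)
    (fun j => W.stateCost Rd (P.traj Ts x u j)) (fun j => ‖angVel (P.traj Ts x u j)‖)
    (fun _ => norm_nonneg _) hq0 (fun _ => norm_nonneg _)
    (fun j hj => ((hcost _ (hmem j hj)).1).trans
      (mul_le_mul_of_nonneg_right (le_add_of_nonneg_right hc₂) (hq0 j)))
    (fun j hj => by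
      have h1 := hrot _ (hXT (hmem j hj.le)) (u j)
      have h2 : rot (P.traj Ts x u j) - Rd = (rot (P.traj Ts x u (j + 1)) - Rd)
          - (rot (P.traj Ts x u (j + 1)) - rot (P.traj Ts x u j)) := by abel
      have h3 := norm_sub_le (rot (P.traj Ts x u (j + 1)) - Rd)
        (rot (P.traj Ts x u (j + 1)) - rot (P.traj Ts x u j))
      rw [← h2] at h3
      have h4 : ‖rot (P.traj Ts x u (j + 1)) - rot (P.traj Ts x u j)‖
        ≤ c₂ * (‖angVel (P.traj Ts x u j)‖ + ‖angVel (P.traj Ts x u (j + 1))‖) := h1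
      have h5 : 0 ≤ c₁ * (‖angVel (P.traj Ts x u j)‖ + ‖angVel (P.traj Ts x u (j + 1))‖) := by
        positivity
      linarith)
    ((hcost _ (hmem N le_rfl)).2.1.trans
      (mul_le_mul_of_nonneg_right (le_add_of_nonneg_right hc₂) (hq0 N)))
    ((Finset.sum_le_sum fun j _ => le_add_of_nonneg_right (inputCost_nonneg _ _ _ _)).trans huB)
  set y := P.traj Ts x u k with hy
  have hyX : y ∈ X := hmem k (by omega)
  set d := stateDist y (hoverState Rd) with hd
  have hdk : W.ζ ^ k * d ^ 2 ≤ (1 + c₁) * K / m := by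
    have h1 : d ^ 2 ≤ (1 + c₁) * (‖rot y - Rd‖ ^ 2 + W.stateCost Rd y) := by
      have := (hcost y hyX).2.2.1
      have g1 : 0 ≤ c₁ * ‖rot y - Rd‖ ^ 2 := by positivity
      have g2 := stateCost_nonneg W Rd y
      linarith
    calc W.ζ ^ k * d ^ 2 ≤ W.ζ ^ k * ((1 + c₁) * (‖rot y - Rd‖ ^ 2 + W.stateCost Rd y)) :=
          mul_le_mul_of_nonneg_left h1 (by positivity)
      _ = (1 + c₁) * (W.ζ ^ k * (‖rot y - Rd‖ ^ 2 + W.stateCost Rd y)) := by ring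
      _ ≤ (1 + c₁) * (K / m) := mul_le_mul_of_nonneg_left hk (by positivity)
      _ = _ := by ring
  have hm0 : (0 : ℝ) < m := by exact_mod_cast hm
  have hsplit : (1 + C₁) * ((1 + c₁) * K) / m = (1 + c₁) * K / m + C₁ * ((1 + c₁) * K / m) := by
    ring
  have hpos : 0 ≤ (1 + c₁) * K / m := by positivity
  have hpos' : 0 ≤ C₁ * ((1 + c₁) * K / m) := by positivity
  have hdε : d < ε := by
    have h1 : d ^ 2 ≤ W.ζ ^ k * d ^ 2 := le_mul_of_one_le_left (sq_nonneg d) (one_le_pow₀ hζ.le)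
    exact lt_of_pow_lt_pow_left₀ 2 hε.le (by linarith)
  -- The shifted sequence starts one step later, so it meets `y` at time `l = k - 1`.
  obtain ⟨l, rfl⟩ := Nat.exists_eq_add_of_le' hk1
  have hshift : ∀ i, P.traj Ts (P.step Ts x (u 0)) (fun j => u (j + 1)) i
      = P.traj Ts x u (i + 1) := fun i => by
    rw [add_comm i 1, traj_add]
    simp only [add_comm 1]
    rfl
  obtain ⟨w, hw, hwc⟩ := hreach (P.step Ts x (u 0)) (fun j => u (j + 1)) l
    (fun i hi => by rw [hshift]; exact hmem _ (by omega))
    (fun i hi => (hu _ (by omega)).2) (by rw [hshift]; exact hdε) N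
  refine ⟨w, hw, hwc.trans ?_⟩
  rw [hshift, ← hy, ← hd]
  have htail : W.ζ ^ l * d ^ 2 ≤ (1 + c₁) * K / m :=
    (mul_le_mul_of_nonneg_right (pow_le_pow_right₀ hζ.le (Nat.le_succ l)) (sq_nonneg d)).trans hdk
  have htail' := mul_le_mul_of_nonneg_left htail hC₁.le
  have hhead : ∑ j ∈ Finset.range l, (W.ζ ^ j * W.stateCost Rd
        (P.traj Ts (P.step Ts x (u 0)) (fun j => u (j + 1)) j)
      + W.inputCost P (P.traj Ts (P.step Ts x (u 0)) (fun j => u (j + 1)) j) (u (j + 1)))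
      ≤ cost P W Rd Ts N x u - W.stateCost Rd x := by
    have h1 := sum_range_le_cost (P := P) (W := W) (Rd := Rd) (Ts := Ts)
      (by omega : l + 1 ≤ N + 1) x u
    rw [Finset.sum_range_succ'] at h1
    have h2 : 0 ≤ W.inputCost P (P.traj Ts x u 0) (u 0) := inputCost_nonneg _ _ _ _
    have h3 : W.stateCost Rd (P.traj Ts x u 0) = W.stateCost Rd x := rfl
    rw [pow_zero, one_mul, h3] at h1
    refine le_trans (Finset.sum_le_sum fun j _ => ?_) (by linarith : _ ≤ _)
    rw [hshift]
    exact add_le_add (mul_le_mul_of_nonneg_right (pow_le_pow_right₀ hζ.le (Nat.le_succ j))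
      (hq0 _)) le_rfl
  linarith

/-- On the controllable set, the value is bounded independently of the horizon. -/
theorem LocallySteerable.exists_valueFn_le {ε C : ℝ} (hst : LocallySteerable P Ts X U Rd ue ε C)
    (h : P.IsHover Rd ue) (hXc : IsCompact X) (hUc : IsCompact U) (W : Weights) (M : ℕ) :
    ∃ B : ℝ, 0 ≤ B ∧ ∀ N : ℕ, ∀ x ∈ controllableSet P Ts X U (hoverState Rd) ε M,
      Feasible P Ts X U N x ∧ valueFn P W Rd Ts X U N x ≤ B := by
  obtain ⟨K, hK, hreach⟩ := hst.exists_admissible h hXc W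
  obtain ⟨Dm, hDm, hD⟩ := exists_stateDist_le hXc Rd
  have hζ := W.one_lt_ζ
  have hζ0 : 0 < W.ζ := one_pos.trans hζ
  -- Until the ball is reached, at most `M` stages occur, each bounded by compactness with weight at
  -- most `ζ^M`; hence the bound is free of `N`.
  obtain ⟨Q, hQ⟩ := (hXc.prod hUc).exists_bound_of_continuousOn
    (f := fun p : State × Control => W.stateCost Rd p.1 + W.inputCost P p.1 p.2)
    (((continuous_stateCost W Rd).comp continuous_fst).add (continuous_inputCost W P)).continuousOn
  refine ⟨M * (W.ζ ^ M * |Q|) + K * (W.ζ ^ M * Dm ^ 2), by positivity, ?_⟩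
  rintro N x ⟨u, k, hkM, huX, huU, hε⟩
  obtain ⟨w, hw, hwc⟩ := hreach x u k huX huU hε N
  refine ⟨⟨w, hw⟩, hw.valueFn_le.trans (hwc.trans (add_le_add ?_ ?_))⟩
  · have hterm : ∀ j ∈ Finset.range k, W.ζ ^ j * W.stateCost Rd (P.traj Ts x u j)
        + W.inputCost P (P.traj Ts x u j) (u j) ≤ W.ζ ^ M * |Q| := by
      intro j hj
      have hj' := Finset.mem_range.1 hj
      have h1 := hQ (P.traj Ts x u j, u j) ⟨huX j hj'.le, huU j hj'⟩
      have h2 := (le_abs_self _).trans (h1.trans (le_abs_self Q))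
      have h3 : 1 ≤ W.ζ ^ M := one_le_pow₀ hζ.le
      have h4 : W.ζ ^ j ≤ W.ζ ^ M := pow_le_pow_right₀ hζ.le (by omega)
      calc _ ≤ W.ζ ^ M * W.stateCost Rd (P.traj Ts x u j)
            + W.ζ ^ M * W.inputCost P (P.traj Ts x u j) (u j) :=
            add_le_add (mul_le_mul_of_nonneg_right h4 (stateCost_nonneg _ _ _))
              (le_mul_of_one_le_left (inputCost_nonneg _ _ _ _) h3)
        _ = W.ζ ^ M * (W.stateCost Rd (P.traj Ts x u j)
            + W.inputCost P (P.traj Ts x u j) (u j)) := by ring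
        _ ≤ _ := mul_le_mul_of_nonneg_left h2 (by positivity)
    have hle := Finset.sum_le_card_nsmul _ _ _ hterm
    rw [Finset.card_range, nsmul_eq_mul] at hle
    exact hle.trans (mul_le_mul_of_nonneg_right (by exact_mod_cast hkM) (by positivity))
  · have h1 := pow_le_pow_left₀ (stateDist_nonneg _ _) (hD _ (huX k le_rfl)) 2
    have h2 : W.ζ ^ k ≤ W.ζ ^ M := pow_le_pow_right₀ hζ.le hkM
    gcongr

end

section

/-! ### The closed loop -/

variable {P : Vehicle} {W : Weights} {Ts : ℝ} {Rd : Mat3} {ue : Control} {X : Set State}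
  {U : Set Control}

/-- The equilibrium is a fixed point of the closed loop. -/
lemma Vehicle.IsHover.closedLoop_eq (h : P.IsHover Rd ue) (hX : hoverState Rd ∈ X) (hU : ue ∈ U)
    {N : ℕ} {κ : State → Control} (hκ : IsMPCFeedback P W Rd Ts X U N κ) :
    closedLoop P Ts κ (hoverState Rd) = hoverState Rd := by
  have hadm : Admissible P Ts X U N (hoverState Rd) fun _ => ue := fun j _ => by
    rw [h.traj_eq]; exact ⟨hX, hU⟩
  obtain ⟨u, hu, hκu⟩ := hκ _ ⟨_, hadm⟩
  have h0 : cost P W Rd Ts N (hoverState Rd) (fun _ => ue) = 0 :=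
    Finset.sum_eq_zero fun j _ => by
      rw [h.traj_eq, stateCost_hoverState, h.inputCost_eq_zero, mul_zero, add_zero]
  -- The optimal value at hover is zero, so the first optimal input has no torque and no resulting
  -- force. This determines the thrust, because `R_d e ≠ 0`.
  have h1 := (stateCost_add_inputCost_le_cost (W := W) (Rd := Rd) (Ts := Ts) (P := P) N
    (hoverState Rd) u).trans (hu.2 _ hadm)
  rw [h0, stateCost_hoverState, zero_add, Weights.inputCost] at h1
  have g1 : 0 ≤ W.kf * ‖P.force (hoverState Rd) (u 0)‖ ^ 2 :=
    mul_nonneg W.kf_pos.le (sq_nonneg _)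
  have g2 : 0 ≤ W.kτ * ‖(u 0).2‖ ^ 2 := mul_nonneg W.kτ_pos.le (sq_nonneg _)
  have hτ : (u 0).2 = 0 := by
    have : W.kτ * ‖(u 0).2‖ ^ 2 = 0 := by linarith
    simpa [W.kτ_pos.ne'] using this
  have hf : P.force (hoverState Rd) (u 0) = 0 := by
    have : W.kf * ‖P.force (hoverState Rd) (u 0)‖ ^ 2 = 0 := by linarith
    simpa [W.kf_pos.ne'] using this
  have hT : (u 0).1 = ue.1 := by
    have h2 : ((u 0).1 - ue.1) • act Rd P.dir = 0 := by
      have := h.force_eq_zero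
      rw [← hf, Vehicle.force, Vehicle.force, add_left_inj] at this
      rw [sub_smul, sub_eq_zero]
      exact this.symm
    rcases smul_eq_zero.1 h2 with h3 | h3
    · exact sub_eq_zero.1 h3
    · have h4 := act_transpose_act h.rot_mem P.dir
      rw [h3, ← actL_apply, map_zero] at h4
      have := P.dir_unit
      rw [← h4, norm_zero] at this
      exact absurd this zero_ne_one
  have hu0 : u 0 = ue := Prod.ext hT (hτ.trans h.torque_eq.symm)
  rw [closedLoop, hκu, hu0, h.step_eq]

/-- Practical asymptotic stability of the closed loop for long horizons. -/
theorem LocallySteerable.practicallyAsymptoticallyStable {ε C : ℝ}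
    (hst : LocallySteerable P Ts X U Rd ue ε C) (h : P.IsHover Rd ue) (hε : 0 < ε)
    (hXc : IsCompact X) (hUc : IsCompact U) (hXT : X ⊆ TSE3) (hX : hoverState Rd ∈ X) (hU : ue ∈ U)
    (W : Weights) (M : ℕ) :
    ∃ (N₀ : ℕ) (ρ : ℕ → ℝ), 4 ≤ N₀ ∧ Tendsto ρ atTop (𝓝 0) ∧ ∀ N : ℕ, N₀ ≤ N →
      ∀ κ : State → Control, IsMPCFeedback P W Rd Ts X U N κ →
        (∀ x₀ ∈ controllableSet P Ts X U (hoverState Rd) ε M, ∀ k : ℕ,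
          Feasible P Ts X U N ((closedLoop P Ts κ)^[k] x₀)) ∧
        PracticallyAsymptoticallyStable (closedLoop P Ts κ) (hoverState Rd)
          (controllableSet P Ts X U (hoverState Rd) ε M) (ρ N) := by
  obtain ⟨B₀, hB₀, hVB⟩ := hst.exists_valueFn_le h hXc hUc W M
  -- The level `B₀ + 1` leaves room for the sublevel `η + δ`, which is below `1` for long horizons.
  obtain ⟨K, hK, hdesc⟩ := hst.exists_descent h hε hXc hXT W (B := B₀ + 1) (by positivity)
  obtain ⟨C₁, hC₁, hreach⟩ := hst.exists_admissible h hXc W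
  obtain ⟨c, hc, hcost⟩ := exists_le_stateCost hXc hXT W h.rot_mem
  obtain ⟨Dm, -, hD⟩ := exists_stateDist_le hXc Rd
  -- The descent is used with `m = N / 2`. If `q ≤ 2δ`, then `d⁴ ≤ 2cδ` and `V ≤ C₁ d² ≤ η`; if `V ≤
  -- η + δ`, then `d⁴ ≤ c q ≤ c V` makes `ρ` a fourth root.
  let δ : ℕ → ℝ := fun N => K / (N / 2 : ℕ)
  let η : ℕ → ℝ := fun N => C₁ * Real.sqrt (2 * c * δ N)
  let ρ : ℕ → ℝ := fun N => Real.sqrt (Real.sqrt (c * (η N + δ N)))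
  have hhalf : Tendsto (fun N : ℕ => N / 2) atTop atTop :=
    tendsto_atTop_atTop.2 fun b => ⟨2 * b, fun a ha => by omega⟩
  have hδ : Tendsto δ atTop (𝓝 0) := (tendsto_const_div_atTop_nhds_zero_nat K).comp hhalf
  have hη : Tendsto η atTop (𝓝 0) := by
    have h1 : Tendsto (fun N => C₁ * Real.sqrt (2 * c * δ N)) atTop
        (𝓝 (C₁ * Real.sqrt (2 * c * 0))) := ((hδ.const_mul _).sqrt).const_mul _
    simpa using h1
  have hρ : Tendsto ρ atTop (𝓝 0) := by
    have h1 : Tendsto (fun N => Real.sqrt (Real.sqrt (c * (η N + δ N)))) atTop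
        (𝓝 (Real.sqrt (Real.sqrt (c * (0 + 0))))) := (((hη.add hδ).const_mul _).sqrt).sqrt
    simpa using h1
  have hηδ : Tendsto (fun N => η N + δ N) atTop (𝓝 0) := by simpa using hη.add hδ
  have hcδ : Tendsto (fun N => 2 * c * δ N) atTop (𝓝 0) := by simpa using hδ.const_mul (2 * c)
  obtain ⟨N₁, hN₁⟩ := eventually_atTop.1 ((hδ.eventually_lt_const (by positivity : 0 < ε ^ 2)).and
    ((hcδ.eventually_lt_const (by positivity : 0 < ε ^ 4)).and
      (hηδ.eventually_lt_const one_pos)))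
  refine ⟨max 4 N₁, ρ, le_max_left _ _, hρ, fun N hN κ hκ => ?_⟩
  have hN4 : 4 ≤ N := (le_max_left _ _).trans hN
  obtain ⟨hδε, hcδε, hηδ1⟩ := hN₁ N ((le_max_right _ _).trans hN)
  have hδ0 : 0 < δ N := by
    have : (0 : ℝ) < (N / 2 : ℕ) := by exact_mod_cast (by omega : 0 < N / 2)
    exact div_pos hK this
  have hη0 : 0 ≤ η N := mul_nonneg hC₁.le (Real.sqrt_nonneg _)
  have hYX : ∀ x, Feasible P Ts X U N x → x ∈ X := fun x ⟨u, hu⟩ => (hu 0 (Nat.zero_le N)).1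
  have hqV : ∀ x, Feasible P Ts X U N x → W.stateCost Rd x ≤ valueFn P W Rd Ts X U N x := by
    intro x hx
    obtain ⟨u, hu, -⟩ := hκ x hx
    rw [hu.valueFn_eq]
    exact (le_add_of_nonneg_right (inputCost_nonneg _ _ _ _)).trans
      (stateCost_add_inputCost_le_cost N x u)
  have hVd : ∀ x ∈ X, stateDist x (hoverState Rd) < ε →
      valueFn P W Rd Ts X U N x ≤ C₁ * stateDist x (hoverState Rd) ^ 2 := by
    intro x hx hxε
    obtain ⟨w, hw, hwc⟩ := hreach x (fun _ => ue) 0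
      (fun i hi => by rw [Nat.le_zero.1 hi]; exact hx) (fun i hi => absurd hi (Nat.not_lt_zero i))
      hxε N
    refine hw.valueFn_le.trans (hwc.trans (le_of_eq ?_))
    simp [Vehicle.traj]
  -- The choice of `r₀` gives `d < ε` and `d ≤ 1`, so `V ≤ C₁ d² ≤ C₁ d ≤ δ` for starts that close.
  have hstable := practical_lyapunov (F := closedLoop P Ts κ) (Y := {x | Feasible P Ts X U N x})
    (S := controllableSet P Ts X U (hoverState Rd) ε M) (V := valueFn P W Rd Ts X U N)
    (q := W.stateCost Rd) (d := fun x => stateDist x (hoverState Rd)) (δ := δ N) (η := η N)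
    (B := B₀ + 1) (ρ := ρ N) (Dmax := Dm) (r₀ := min (min ε 1) (δ N / C₁)) hδ0 hη0
    (by positivity) (by linarith) (fun x _ => stateCost_nonneg _ _ _)
    (fun x hx hVx => by
      obtain ⟨u, hu, hκu⟩ := hκ x hx
      rw [hu.valueFn_eq] at hVx
      obtain ⟨w, hw, hwc⟩ := hdesc N (N / 2) (by omega) (by omega) hδε x u hu.1 hVx
      rw [closedLoop, hκu, hu.valueFn_eq]
      exact ⟨⟨w, hw⟩, hw.valueFn_le.trans hwc⟩)
    (fun x hx hqx => by
      have hxX := hYX x hx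
      have h4 : (stateDist x (hoverState Rd) ^ 2) ^ 2 ≤ 2 * c * δ N := by
        calc (stateDist x (hoverState Rd) ^ 2) ^ 2 = stateDist x (hoverState Rd) ^ 4 := by ring
          _ ≤ c * W.stateCost Rd x := (hcost x hxX).2.2.2
          _ ≤ c * (2 * δ N) := mul_le_mul_of_nonneg_left hqx hc.le
          _ = _ := by ring
      have hdε : stateDist x (hoverState Rd) < ε :=
        lt_of_pow_lt_pow_left₀ 4 hε.le (by linarith)
      exact (hVd x hxX hdε).trans (mul_le_mul_of_nonneg_left (Real.le_sqrt_of_sq_le h4) hC₁.le))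
    (fun x hx hVx => by
      have h4 : (stateDist x (hoverState Rd) ^ 2) ^ 2 ≤ c * (η N + δ N) := by
        calc (stateDist x (hoverState Rd) ^ 2) ^ 2 = stateDist x (hoverState Rd) ^ 4 := by ring
          _ ≤ c * W.stateCost Rd x := (hcost x (hYX x hx)).2.2.2
          _ ≤ _ := mul_le_mul_of_nonneg_left ((hqV x hx).trans hVx) hc.le
      exact Real.le_sqrt_of_sq_le (Real.le_sqrt_of_sq_le h4))
    (fun x hx => hD x (hYX x hx))
    (fun x hx => ⟨(hVB N x hx).1, (hVB N x hx).2.trans (by linarith)⟩)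
    (fun x hx hxr => by
      have e1 := hxr.trans_le ((min_le_left _ _).trans (min_le_left _ _))
      have e2 := hxr.trans_le ((min_le_left _ _).trans (min_le_right _ _))
      have e3 := hxr.trans_le (min_le_right _ _)
      rw [lt_div_iff₀ hC₁] at e3
      have e4 := stateDist_nonneg x (hoverState Rd)
      refine (hVd x (hYX x (hVB N x hx).1) e1).trans ?_
      have e5 : stateDist x (hoverState Rd) ^ 2 ≤ stateDist x (hoverState Rd) := by
        rw [sq]; exact mul_le_of_le_one_left e4 e2.le
      have e6 := mul_le_mul_of_nonneg_left e5 hC₁.le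
      linarith)
  refine ⟨hstable.1, h.closedLoop_eq hX hU hκ, ?_, Real.sqrt_nonneg _, hstable.2⟩
  refine ⟨fun _ => ue, 0, Nat.zero_le _, fun i hi => ?_, fun i hi => absurd hi (Nat.not_lt_zero i),
    ?_⟩
  · rw [h.traj_eq]; exact hX
  · have h0 : stateDist (hoverState Rd) (hoverState Rd) = 0 := by simp [stateDist]
    exact h0.trans_lt hε

theorem Vehicle.IsHover.exists_stable (h : P.IsHover Rd ue) :
    ∃ T₀ : ℝ, 0 < T₀ ∧ ∀ Ts : ℝ, 0 < Ts → Ts < T₀ → ∀ (X : Set State) (U : Set Control),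
      X ⊆ TSE3 → IsCompact X → IsCompact U → X ∈ 𝓝[TSE3] (hoverState Rd) → U ∈ 𝓝 ue →
      ∃ ε : ℝ, 0 < ε ∧ ∀ (W : Weights) (M : ℕ),
        ∃ (N₀ : ℕ) (ρ : ℕ → ℝ), 4 ≤ N₀ ∧ Tendsto ρ atTop (𝓝 0) ∧ ∀ N : ℕ, N₀ ≤ N →
          (∀ x, Feasible P Ts X U N x → ∃ u, IsOptimal P W Rd Ts X U N x u) ∧
          ∀ κ : State → Control, IsMPCFeedback P W Rd Ts X U N κ →
            (∀ x₀ ∈ controllableSet P Ts X U (hoverState Rd) ε M, ∀ k : ℕ,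
              Feasible P Ts X U N ((closedLoop P Ts κ)^[k] x₀)) ∧
            PracticallyAsymptoticallyStable (closedLoop P Ts κ) (hoverState Rd)
              (controllableSet P Ts X U (hoverState Rd) ε M) (ρ N) := by
  have hm := P.mass_pos
  -- The two smallness conditions on `Ts` from the controllability argument; the `+ 1` avoids
  -- division by zero when the force derivative vanishes.
  refine ⟨min 1 (2 * P.mass / (‖P.forceDeriv‖ + 1)), by positivity,
    fun Ts hTs hTs₀ X U hXT hXc hUc hX hU => ?_⟩
  have hTs1 : Ts ≤ 1 := hTs₀.le.trans (min_le_left _ _)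
  have hTs2 : Ts * ‖P.forceDeriv‖ < 2 * P.mass := by
    have := hTs₀.trans_le (min_le_right _ _)
    rw [lt_div_iff₀ (by positivity)] at this
    linarith
  obtain ⟨ε, C, hε, -, hst⟩ := h.exists_locallySteerable hTs hTs1 hTs2 hXT hX hU
  refine ⟨ε, hε, fun W M => ?_⟩
  obtain ⟨N₀, ρ, hN₀, hρ, hN⟩ := hst.practicallyAsymptoticallyStable h hε hXc hUc hXT
    (mem_of_mem_nhdsWithin h.rot_mem hX) (mem_of_mem_nhds hU) W M
  exact ⟨N₀, ρ, hN₀, hρ, fun N hle => ⟨fun x hx => exists_isOptimal hXc hUc W Rd hx, hN N hle⟩⟩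

end

end SE3MPC

end

theorem mainTheorem2 (P : SE3MPC.Vehicle) (Rd : SE3MPC.Mat3) (hRd : Rd ∈ SE3MPC.SO3)
    (xe : SE3MPC.State) (hxe : xe = (Rd, 0, 0, 0))
    (ue : SE3MPC.Control) (hue_torque : ue.2 = 0) (hue_thrust : ue.1 ≠ 0)
    (hforce : P.force xe ue = 0) (htorque : P.torque xe ue = 0) :
    ∃ T₀ : ℝ, 0 < T₀ ∧ ∀ Ts : ℝ, 0 < Ts → Ts < T₀ →
      ∀ (X : Set SE3MPC.State) (U : Set SE3MPC.Control),
        X ⊆ SE3MPC.TSE3 → IsCompact X → IsCompact U → X ∈ 𝓝[SE3MPC.TSE3] xe → U ∈ 𝓝 ue →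
        ∃ ε : ℝ, 0 < ε ∧ ∀ (W : SE3MPC.Weights) (M : ℕ),
          ∃ (N₀ : ℕ) (ρ : ℕ → ℝ), 4 ≤ N₀ ∧ Tendsto ρ atTop (𝓝 0) ∧ ∀ N : ℕ, N₀ ≤ N →
            (∀ x, SE3MPC.Feasible P Ts X U N x →
              ∃ u, SE3MPC.IsOptimal P W Rd Ts X U N x u) ∧
            ∀ κ : SE3MPC.State → SE3MPC.Control,
              SE3MPC.IsMPCFeedback P W Rd Ts X U N κ →
                (∀ x₀ ∈ SE3MPC.controllableSet P Ts X U xe ε M, ∀ k : ℕ,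
                  SE3MPC.Feasible P Ts X U N ((SE3MPC.closedLoop P Ts κ)^[k] x₀)) ∧
                SE3MPC.PracticallyAsymptoticallyStable (SE3MPC.closedLoop P Ts κ) xe
                  (SE3MPC.controllableSet P Ts X U xe ε M) (ρ N) := by
  subst hxe
  exact SE3MPC.Vehicle.IsHover.exists_stable ⟨hRd, hue_torque, hue_thrust, hforce, htorque⟩
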